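/- **Setting.** Let $F$ be a free group of finite rank $k\ge 2$. Let $\Gamma$ be a finite connected graph (loops and multiple edges allowed) without degree-one vertices, with set of oriented edges $E\Gamma$; write $o(e),t(e)$ for the origin and terminus of $e$ and $e^{-1}$ for the reversed edge. Let $\alpha:F\to\pi_1(\Gamma,p)$ be an isomorphism. Let $\mathcal L$ be a non-singular semi-metric structure on $\Gamma$, that is, lengths $L(e)=L(e^{-1})\ge 0$ such that $L(e)>0$ for all edges $e$ outside some maximal tree of $\Gamma$ (in particular, every $L(e)$ may be positive). Let $j:X\to\Gamma$ be the universal cover, a tree, with the lifted lengths $L(f)=L(j(f))$, the induced semi-metric $d$ on the geometric realization of $X$, and the action of $F$ on $X$ by deck transformations through $\alpha$. Let $\partial X$ be the space of ends of $X$ and $\partial^2X=\{(\xi,\zeta)\in\partial X\times\partial X:\xi\neq\zeta\}$; for $(\xi,\zeta)\in\partial^2X$ let $[\xi,\zeta]$ be the geodesic line from $\xi$ to $\zeta$. For a reduced edge-path $\gamma$ in $X$ with origin $x$ let $Cyl_x(\gamma)\subseteq\partial X$ be the set of ends $\xi$ such that $\gamma$ is an initial segment of $[x,\xi]$, and let $Cyl_X(\gamma)\subseteq\partial^2X$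 be the set of pairs $(\xi,\zeta)$ such that $[\xi,\zeta]$ contains $\gamma$ with the same orientation. Let $h=h(\mathcal L)$ be the critical exponent: for every point $x\in X$ the series $\sum_{g\in F}e^{-s\,d(x,gx)}$ converges for $s>h$ and diverges for $s<h$. A family of *Patterson–Sullivan measures* is a family $(\mu_x)_{x\in X}$ of finite regular Borel measures on $\partial X$, not all zero, depending weak-$*$ continuously on the point $x\in X$, such that for all $x,y\in X$, $g\in F$: 1. $\mu_{gx}=g_*\mu_x$, where $(g_*\mu)(A)=\mu(g^{-1}A)$; 2. $\dfrac{d\mu_x}{d\mu_y}(\xi)=e^{-hB_\xi(x,y)}$, where $B_\xi(x,y)=\lim_{X\ni u\to\xi}\big(d(x,u)-d(y,u)\big)$; 3. $\mu_x=\mu_y$ whenever $d(x,y)=0$. Given such a family, an *$X$-Patterson–Sullivan current* is a nonzero, locally finite, $F$-invariant and flip-invariant Borel measure $\nu$ on $\partial^2X$ in the measure class of $\mu_y\times\mu_y$ for every $y\in X$, which for every $y\in X$ has, up to a positive scalar multiple, the form $e^{2hf(\xi,\zeta)}\,d\mu_y(\xi)\,d\mu_y(\zeta)$ with $f:\partial^2X\to[0,\infty)$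 symmetric, Borel and within bounded distance of $d(x,[\xi,\zeta])$ for every $x\in X$. For $e\in E\Gamma$ let $w_e=\mu_x(Cyl_x(f))$, where $f$ is any lift of $e$ to $X$ and $x=o(f)$, and let $b(e)$ be the set of all $e_1\in E\Gamma$ with $o(e_1)=t(e)$ and $e_1\ne e^{-1}$. **Proposition 5.3.** Let $(\mu_x)_{x\in X}$ be a family of Patterson–Sullivan measures on $\partial X$ and let $z\in X$. Then the measure $\nu$ on $\partial^2X$ given by $$d\nu(\xi,\zeta)=e^{2h\,d(z,[\xi,\zeta])}\,d\mu_z(\xi)\,d\mu_z(\zeta)$$ is an $X$-Patterson–Sullivan current. Moreover, for every reduced edge-path $\gamma$ in $X$ with at least one edge, of total length $L(\gamma)$, $$\nu(Cyl_X(\gamma))=e^{-hL(\gamma)}\Big(\sum_{e\in b(e')}w_e\Big)\Big(\sum_{e\in b(e'')}w_e\Big),$$ where $(e')^{-1}\in E\Gamma$ is the image under $j$ of the first edge of $\gamma$ and $e''\in E\Gamma$ is the image of the last edge of $\gamma$. -/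

import Mathlib

open Set Filter Topology MeasureTheory

/-- A graph in the sense of Serre, with vertex set `V` and set `E` of oriented edges: `o e` is the
origin of `e`, and `bar e` is `e` with the opposite orientation. Loops and multiple edges are
allowed. -/
structure SerreGraph (V E : Type*) where
  o : E → V
  bar : E → E
  bar_bar : ∀ e, bar (bar e) = e
  bar_ne : ∀ e, bar e ≠ e

namespace SerreGraph

section Graph

variable {V E : Type*} (G : SerreGraph V E)

/-- The terminus of an oriented edge. -/
def t (e : E) : V := G.o (G.bar e)

/-- `G.IsPath u l v`: the list `l` of oriented edges is an edge-path from `u` to `v`. -/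
def IsPath : V → List E → V → Prop
  | u, [], v => u = v
  | u, e :: l, v => G.o e = u ∧ IsPath (G.t e) l v

/-- The list of oriented edges is an edge-path without back-tracking. -/
def IsReduced (l : List E) : Prop :=
  l.IsChain (fun e f => G.t e = G.o f ∧ f ≠ G.bar e)

def IsConnected : Prop := Nonempty V ∧ ∀ u v, ∃ l, G.IsPath u l v

/-- A tree: any two vertices are joined by exactly one reduced path. -/
def IsTree : Prop := Nonempty V ∧ ∀ u v, ∃! l, G.IsPath u l v ∧ G.IsReduced l

/-- `b(e)`: the oriented edges `f` such that `e f` is a reduced path. -/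
noncomputable def b [Fintype E] (e : E) : Finset E := by
  classical exact Finset.univ.filter (fun f => G.t e = G.o f ∧ f ≠ G.bar e)

/-! ### The fundamental group -/

theorem IsPath.append {u v w : V} {l m : List E} (hl : G.IsPath u l v) (hm : G.IsPath v m w) :
    G.IsPath u (l ++ m) w := by
  induction l generalizing u with
  | nil => cases hl; exact hm
  | cons e l ih => exact ⟨hl.1, ih hl.2⟩

/-- The path traversed backwards. -/
def rev (l : List E) : List E := (l.map G.bar).reverse

theorem IsPath.rev {u v : V} {l : List E} (hl : G.IsPath u l v) : G.IsPath v (G.rev l) u := by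
  induction l generalizing u with
  | nil => exact Eq.symm hl
  | cons e l ih =>
    have h : G.rev (e :: l) = G.rev l ++ [G.bar e] := by simp [SerreGraph.rev]
    rw [h]
    refine IsPath.append G (ih hl.2) ⟨rfl, ?_⟩
    show G.o (G.bar (G.bar e)) = u
    rw [G.bar_bar]
    exact hl.1

/-- Closed edge-paths at `p`. -/
abbrev Loop (p : V) : Type _ := {l : List E // G.IsPath p l p}

/-- Elementary homotopy of closed paths: deleting a back-tracking `e (bar e)`. -/
def Step (p : V) (l m : G.Loop p) : Prop :=
  ∃ (a c : List E) (e : E), l.1 = a ++ e :: G.bar e :: c ∧ m.1 = a ++ c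

/-- The fundamental group `π₁(G, p)`: closed edge-paths at `p` modulo the equivalence relation
generated by elementary homotopies; the product is concatenation. -/
def FundamentalGroup (p : V) : Type _ := Quot (G.Step p)

/-- The homotopy class of a closed path. -/
def loopClass {p : V} (l : G.Loop p) : G.FundamentalGroup p := Quot.mk _ l

theorem rev_loopClass {u p : V} (l : List E) (hl : G.IsPath u l p)
    (h : G.IsPath p (G.rev l ++ l) p) : G.loopClass ⟨G.rev l ++ l, h⟩ = G.loopClass ⟨[], rfl⟩ := by
  induction l generalizing u with
  | nil => rfl
  | cons e l ih =>
    have hh := IsPath.append G (IsPath.rev G hl.2) hl.2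
    rw [← ih hl.2 hh]
    exact Quot.sound ⟨G.rev l, l, G.bar e, by simp [SerreGraph.rev, G.bar_bar], rfl⟩

instance (p : V) : Mul (G.FundamentalGroup p) :=
  ⟨Quot.map₂ (fun l m => ⟨l.1 ++ m.1, IsPath.append G l.2 m.2⟩)
    (by
      rintro l m m' ⟨a, c, e, h, h'⟩
      exact ⟨l.1 ++ a, c, e, by simp [h], by simp [h']⟩)
    (by
      rintro l l' m ⟨a, c, e, h, h'⟩
      exact ⟨a, c ++ m.1, e, by simp [h], by simp [h']⟩)⟩

instance (p : V) : Inv (G.FundamentalGroup p) :=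
  ⟨Quot.map (fun l => ⟨G.rev l.1, IsPath.rev G l.2⟩)
    (by
      rintro l m ⟨a, c, e, h, h'⟩
      exact ⟨G.rev c, G.rev a, e, by simp [h, SerreGraph.rev, G.bar_bar],
        by simp [h', SerreGraph.rev]⟩)⟩

instance (p : V) : One (G.FundamentalGroup p) := ⟨G.loopClass ⟨[], rfl⟩⟩

instance (p : V) : Group (G.FundamentalGroup p) :=
  Group.ofLeftAxioms
    (by
      rintro ⟨a⟩ ⟨c⟩ ⟨d⟩
      exact congrArg (Quot.mk _) (Subtype.ext (List.append_assoc a.1 c.1 d.1)))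
    (by rintro ⟨a⟩; rfl)
    (by rintro ⟨a⟩; exact G.rev_loopClass a.1 a.2 _)

/-! ### Semi-metric structures -/

/-- A semi-metric structure: nonnegative lengths of edges, independent of the orientation. -/
structure SemiMetric where
  len : E → ℝ
  len_nonneg : ∀ e, 0 ≤ len e
  len_bar : ∀ e, len (G.bar e) = len e

/-- Non-singularity: all edges outside some maximal tree `T` (a spanning tree, given by its set of
oriented edges) have positive length. -/
def SemiMetric.Nonsingular {G : SerreGraph V E} (L : G.SemiMetric) : Prop :=
  ∃ T : Set E, (∀ e ∈ T, G.bar e ∈ T) ∧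
    (∀ u v, ∃! l, G.IsPath u l v ∧ G.IsReduced l ∧ ∀ e ∈ l, e ∈ T) ∧
    ∀ e ∉ T, 0 < L.len e

/-! ### The geometric realization and its semi-metric -/

/-- The gluing relation on `V ⊔ (E × [0,1])`: the start of the segment of `e` is glued to the vertex
`o e`, and the segments of `e` and `bar e` are identified by reversal. -/
inductive Glue : V ⊕ (E × unitInterval) → V ⊕ (E × unitInterval) → Prop
  | zero (e : E) : Glue (Sum.inr (e, 0)) (Sum.inl (G.o e))
  | flip (e : E) (s : unitInterval) :
      Glue (Sum.inr (e, s)) (Sum.inr (G.bar e, unitInterval.symm s))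

/-- The points of the graph regarded as a one-dimensional cell complex. -/
def Point : Type _ := Quot G.Glue

/-- A vertex as a point. -/
def vertex (v : V) : G.Point := Quot.mk _ (Sum.inl v)

/-- The point at fraction `s` of the edge `e`, counted from `o e`. -/
def onEdge (e : E) (s : unitInterval) : G.Point := Quot.mk _ (Sum.inr (e, s))

/-- The weak topology: a set is open iff its trace on every closed edge is open. -/
instance : TopologicalSpace G.Point :=
  ⨆ e : E, TopologicalSpace.coinduced (G.onEdge e) inferInstance

/-- `x` lies on a segment starting at the vertex `u`, at distance `a` along the segment. -/
def Tether (ℓ : E → ℝ) (x : G.Point) (u : V) (a : ℝ) : Prop :=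
  (x = G.vertex u ∧ a = 0) ∨
    ∃ (e : E) (s : unitInterval), x = G.onEdge e s ∧ G.o e = u ∧ a = s * ℓ e

/-- The length semi-metric on points: the infimum of the lengths of the paths from `x` to `y` that
consist of a segment to a vertex, an edge-path and a segment from a vertex, or of a single segment
inside one edge. -/
noncomputable def dist (ℓ : E → ℝ) (x y : G.Point) : ℝ :=
  sInf {r : ℝ |
    (∃ (u v : V) (a c : ℝ) (l : List E), G.Tether ℓ x u a ∧ G.Tether ℓ y v c ∧
      G.IsPath u l v ∧ r = a + (l.map ℓ).sum + c) ∨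
    ∃ (e : E) (s s' : unitInterval), x = G.onEdge e s ∧ y = G.onEdge e s' ∧
      r = |(s : ℝ) - s'| * ℓ e}

/-! ### The space of ends of a tree -/

/-- Infinite reduced edge-paths. -/
def Ray : Type _ :=
  {r : ℕ → E // ∀ n, G.t (r n) = G.o (r (n + 1)) ∧ r (n + 1) ≠ G.bar (r n)}

/-- Two rays are cofinal if they agree after deleting initial segments. -/
def cofinal : Setoid G.Ray where
  r r r' := ∃ m n : ℕ, ∀ k, r.1 (m + k) = r'.1 (n + k)
  iseqv :=
    { refl := fun _ => ⟨0, 0, fun _ => rfl⟩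
      symm := by
        rintro r r' ⟨m, n, h⟩
        exact ⟨n, m, fun k => (h k).symm⟩
      trans := by
        rintro r r' r'' ⟨m, n, h⟩ ⟨m', n', h'⟩
        refine ⟨m + m', n' + n, fun k => ?_⟩
        have e₁ : n + (m' + k) = m' + (n + k) := by omega
        rw [add_assoc, h, e₁, h', add_assoc] }

/-- The boundary `∂G` of a tree `G`: its ends, as cofinality classes of rays. -/
def Boundary : Type _ := Quotient G.cofinal

/-- The end of a ray. -/
def Ray.toEnd {G : SerreGraph V E} (r : G.Ray) : G.Boundary := Quotient.mk G.cofinal r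

/-- `Cyl_x(γ)` for a path `γ` with origin `x`: the ends `ξ` such that `γ` is an initial segment of
the ray `[x, ξ]`. -/
def cyl (γ : List E) : Set G.Boundary :=
  {ξ | ∃ r : G.Ray, r.toEnd = ξ ∧ ∀ (i : ℕ) (hi : i < γ.length), r.1 i = γ[i]}

/-- The topology of the space of ends, generated by the cylinder sets. -/
instance : TopologicalSpace G.Boundary :=
  TopologicalSpace.generateFrom {S | ∃ γ : List E, S = G.cyl γ}

instance : MeasurableSpace G.Boundary := borel _

instance : BorelSpace G.Boundary := ⟨rfl⟩

/-- `∂²G`: ordered pairs of distinct ends. -/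
abbrev Boundary₂ : Type _ := {q : G.Boundary × G.Boundary // q.1 ≠ q.2}

/-- The bi-infinite reduced edge-path `c` runs from the end `ξ` to the end `ζ`. -/
def IsLine (c : ℤ → E) (ξ ζ : G.Boundary) : Prop :=
  (∀ n, G.t (c n) = G.o (c (n + 1)) ∧ c (n + 1) ≠ G.bar (c n)) ∧
  ∃ r r' : G.Ray, r.toEnd = ξ ∧ r'.toEnd = ζ ∧
    ∀ n : ℕ, r.1 n = G.bar (c (-1 - n)) ∧ r'.1 n = c n

/-- The set of points of the geodesic `[ξ, ζ]`. -/
def line (ξ ζ : G.Boundary) : Set G.Point :=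
  {x | ∃ (c : ℤ → E) (n : ℤ) (s : unitInterval), G.IsLine c ξ ζ ∧ x = G.onEdge (c n) s}

/-- `Cyl(γ) ⊆ ∂²G`: the pairs `(ξ, ζ)` such that `[ξ, ζ]` contains `γ` with the same
orientation. -/
def cyl₂ (γ : List E) : Set G.Boundary₂ :=
  {q | ∃ (c : ℤ → E) (n : ℤ), G.IsLine c q.1.1 q.1.2 ∧
    ∀ (i : ℕ) (hi : i < γ.length), c (n + i) = γ[i]}

/-- The distance `d(z, [ξ, ζ])`. -/
noncomputable def distLine (ℓ : E → ℝ) (z : G.Point) (q : G.Boundary₂) : ℝ :=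
  sInf (G.dist ℓ z '' G.line q.1.1 q.1.2)

/-- The points beyond `o e` in the direction of `e` (in a tree): those lying on the last edge of a
reduced path that starts with `e`. -/
def shadow (e : E) : Set G.Point :=
  {z | ∃ (l : List E) (s : unitInterval), G.IsReduced (e :: l) ∧
    z = G.onEdge ((e :: l).getLast (List.cons_ne_nil e l)) s}

/-- The filter of neighbourhoods of the end `ξ` in `G ∪ ∂G`, restricted to the points of `G`. -/
def atEnd (ξ : G.Boundary) : Filter G.Point :=
  ⨅ e ∈ {e : E | ξ ∈ G.cyl [e]}, 𝓟 (G.shadow e)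

/-- The Busemann function `B_ξ(x, y) = lim_{z → ξ} (d(x, z) - d(y, z))`. -/
noncomputable def busemann (ℓ : E → ℝ) (ξ : G.Boundary) (x y : G.Point) : ℝ :=
  limUnder (G.atEnd ξ) (fun z => G.dist ℓ x z - G.dist ℓ y z)

end Graph

/-! ### Covering maps and group actions -/

/-- A covering map of graphs: a morphism that maps the edges starting at a vertex bijectively to
the edges starting at its image. -/
structure Covering {V E V' E' : Type*} (X : SerreGraph V E) (Γ : SerreGraph V' E') where
  onV : V → V'
  onE : E → E'
  onE_o : ∀ e, Γ.o (onE e) = onV (X.o e)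
  onE_bar : ∀ e, onE (X.bar e) = Γ.bar (onE e)
  lift : ∀ (x : V) (e : E'), Γ.o e = onV x → ∃! f : E, X.o f = x ∧ onE f = e

section Action

variable (F : Type*) [Group F] {V E : Type*} [MulAction F V] [MulAction F E]

/-- The group `F` acts on the graph by automorphisms. -/
class Acts (X : SerreGraph V E) : Prop where
  smul_o : ∀ (g : F) (e : E), X.o (g • e) = g • X.o e
  smul_bar : ∀ (g : F) (e : E), X.bar (g • e) = g • X.bar e

/-- `F` acts on the covering `X` of `Γ` by deck transformations through
`α : F ≃* π₁(Γ, p)`, where `x₀` is a lift of `p`: the vertex `g x₀` is the endpoint of the lift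
starting at `x₀` of every closed path representing `α g`. -/
structure ActsThrough {V' E' : Type*} {X : SerreGraph V E} {Γ : SerreGraph V' E'}
    (j : Covering X Γ) (x₀ : V) (α : F ≃* Γ.FundamentalGroup (j.onV x₀)) : Prop where
  onV_smul : ∀ (g : F) (v : V), j.onV (g • v) = j.onV v
  onE_smul : ∀ (g : F) (e : E), j.onE (g • e) = j.onE e
  smul_base : ∀ (g : F) (m : Γ.Loop (j.onV x₀)), α g = Γ.loopClass m →
    ∃ l : List E, l.map j.onE = m.1 ∧ X.IsPath x₀ l (g • x₀)

variable {F} (X : SerreGraph V E) [Acts F X]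

theorem smul_t (g : F) (e : E) : X.t (g • e) = g • X.t e := by
  rw [t, Acts.smul_bar, Acts.smul_o, t]

/-- The action on points. -/
instance : SMul F X.Point where
  smul g := Quot.map (Sum.map (g • ·) (Prod.map (g • ·) id)) (by
    rintro _ _ (⟨e⟩ | ⟨e, s⟩)
    · simp only [Sum.map_inr, Sum.map_inl, Prod.map_apply, id]
      rw [← Acts.smul_o (X := X)]
      exact Glue.zero _
    · simp only [Sum.map_inr, Prod.map_apply, id]
      rw [← Acts.smul_bar (X := X)]
      exact Glue.flip _ _)

/-- The translate of a ray. -/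
def Ray.translate {X : SerreGraph V E} [Acts F X] (g : F) (r : X.Ray) : X.Ray :=
  ⟨fun n => g • r.1 n, fun n => by
    rw [smul_t, Acts.smul_o, Acts.smul_bar, (r.2 n).1]
    exact ⟨rfl, fun h => (r.2 n).2 (MulAction.injective g h)⟩⟩

/-- The action on the boundary. -/
instance : MulAction F X.Boundary where
  smul g := Quotient.map (Ray.translate g) (by
    rintro r r' ⟨m, n, h⟩
    exact ⟨m, n, fun k => congrArg (g • ·) (h k)⟩)
  one_smul := by
    rintro ⟨r⟩
    exact congrArg (Quotient.mk _) (Subtype.ext (funext fun n => one_smul F (r.1 n)))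
  mul_smul := by
    rintro g g' ⟨r⟩
    exact congrArg (Quotient.mk _) (Subtype.ext (funext fun n => mul_smul g g' (r.1 n)))

/-- The diagonal action on pairs of distinct ends. -/
instance : SMul F X.Boundary₂ where
  smul g q := ⟨(g • q.1.1, g • q.1.2), fun h => q.2 (MulAction.injective g h)⟩

variable (F)

/-- The critical exponent: the abscissa of convergence of the Poincaré series
`∑ g, exp (-s d(x, g x))`. -/
noncomputable def criticalExponent (ℓ : E → ℝ) : ℝ :=
  sInf {s : ℝ | 0 ≤ s ∧ ∀ x : X.Point, Summable fun g : F => Real.exp (-s * X.dist ℓ x (g • x))}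

/-- An `h`-dimensional conformal density. `FiniteMeasure` carries the weak-* topology, and finite
Borel measures on the compact metrizable space `∂X` are regular. -/
structure IsConformalDensity (ℓ : E → ℝ) (h : ℝ) (μ : X.Point → FiniteMeasure X.Boundary) :
    Prop where
  continuous : Continuous μ
  equivariant : ∀ (g : F) (x : X.Point),
    (μ (g • x) : Measure X.Boundary) = (μ x : Measure X.Boundary).map (g • ·)
  density : ∀ x y : X.Point, (μ x : Measure X.Boundary) =
    (μ y : Measure X.Boundary).withDensity
      fun ξ => ENNReal.ofReal (Real.exp (-h * X.busemann ℓ ξ x y))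
  eq_of_dist : ∀ x y : X.Point, X.dist ℓ x y = 0 → μ x = μ y

/-- Patterson–Sullivan measures: a nonzero conformal density whose dimension is the critical
exponent. -/
def IsPattersonSullivan (ℓ : E → ℝ) (μ : X.Point → FiniteMeasure X.Boundary) : Prop :=
  X.IsConformalDensity F ℓ (X.criticalExponent F ℓ) μ ∧ ∃ x, μ x ≠ 0

end Action

section Current

variable {V E : Type*} (X : SerreGraph V E)

/-- The restriction to `∂²X` of the product measure `m × m` on `∂X × ∂X`. -/
noncomputable def offDiag (m : FiniteMeasure X.Boundary) : Measure X.Boundary₂ :=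
  ((m : Measure X.Boundary).prod (m : Measure X.Boundary)).comap Subtype.val

/-- The flip `(ξ, ζ) ↦ (ζ, ξ)`. -/
def flip (q : X.Boundary₂) : X.Boundary₂ := ⟨(q.1.2, q.1.1), q.2.symm⟩

/-- `ν` is a Patterson–Sullivan current for the Patterson–Sullivan measures `μ`: a nonzero, locally
finite, `F`-invariant and flip-invariant measure in the measure class of `μ_y × μ_y`, of the form
`exp (2 h f) d(μ_y × μ_y)` up to a scalar, with `f` nonnegative, Borel, symmetric and within bounded
distance of `d(x, [ξ, ζ])`. -/
structure IsPSCurrent (F : Type*) [Group F] [MulAction F V] [MulAction F E] [Acts F X]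
    (ℓ : E → ℝ) (μ : X.Point → FiniteMeasure X.Boundary) (ν : Measure X.Boundary₂) : Prop where
  ne_zero : ν ≠ 0
  locallyFinite : IsLocallyFiniteMeasure ν
  invariant : ∀ g : F, ν.map (g • ·) = ν
  flip_invariant : ν.map X.flip = ν
  measure_class : ∀ y, ν ≪ X.offDiag (μ y) ∧ X.offDiag (μ y) ≪ ν
  density : ∀ y, ∃ (a : ENNReal) (f : X.Boundary₂ → ℝ), a ≠ 0 ∧ a ≠ ⊤ ∧ Measurable f ∧
    (∀ q, 0 ≤ f q) ∧ (∀ q, f (X.flip q) = f q) ∧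
    (∀ x, ∃ C, ∀ q, |f q - X.distLine ℓ x q| ≤ C) ∧
    ν = a • (X.offDiag (μ y)).withDensity
      fun q => ENNReal.ofReal (Real.exp (2 * X.criticalExponent F ℓ * f q))

/-- The measure `exp (2 h d(z, [ξ, ζ])) dμ_z(ξ) dμ_z(ζ)` on `∂²X`. -/
noncomputable def psMeasure (ℓ : E → ℝ) (h : ℝ) (μ : X.Point → FiniteMeasure X.Boundary)
    (z : X.Point) : Measure X.Boundary₂ :=
  (X.offDiag (μ z)).withDensity fun q => ENNReal.ofReal (Real.exp (2 * h * X.distLine ℓ z q))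

/-- The weight `w_e = μ_x(Cyl_x(f))` of an edge `e`, computed from a lift `f` of `e` to `X` with
origin `x`. -/
noncomputable def weight (μ : X.Point → FiniteMeasure X.Boundary) (f : E) : ENNReal :=
  (μ (X.vertex (X.o f)) : Measure X.Boundary) (X.cyl [f])

end Current
end SerreGraph

/-!
The geometry of the tree enters through its Busemann functions. Distances from a vertex are
`1`-Lipschitz on the geometric realization (`abs_vertexDist_sub_le`), which identifies `dist` along
reduced paths with the difference of positions (`dist_of_isReduced`, `Ray.dist_shadow`). Hence
`d(x, u) - d(y, u)` is constant once `u` lies far enough towards an end `ξ`: the Busemann function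
`B_ξ(x, y)` is this constant, is locally constant in `ξ`, and is a cocycle in `(x, y)`.

The rays from a point `z` to two ends `ξ`, `ζ` run through a common projection of `z` to the line
`[ξ, ζ]` (`exists_projection`), and `B_ξ + B_ζ` vanishes between points of the line. This gives
`2 d(z, [ξ, ζ]) = B_ξ(z, p) + B_ζ(z, p)` for all `p` on the line (`two_mul_distLine`), so that
`2 d(z, [ξ, ζ]) = B_ξ(z, y) + B_ζ(z, y) + 2 d(y, [ξ, ζ])`. Together with the conformality
`dμ_z = exp (-h B_ξ(z, y)) dμ_y` it shows that `exp (2 h d(z, [ξ, ζ])) dμ_z(ξ) dμ_z(ζ)` does not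
depend on the base point `z` (`psMeasure_eq`). Invariance under the group, the form of the density
with respect to any `μ_y`, and local finiteness follow at once; the density is `1` on the lines
through the base point. The measure is nonzero because otherwise `μ_z` would be concentrated at a
single end, fixed by the whole group; but the action is free, so stabilizers of ends are abelian
(`ActsThrough.commute_of_smul_end`).

For the values on cylinders, the base point is moved to the origin of the path `γ`. The cylinder is
the product of the sets of ends behind the first and in front of the last edge of `γ`
(`IsTree.image_cyl₂`). Each of them is divided according to the next edge
(`measure_cyl_eq_sum`), and `B_ξ` between the ends of `γ` equals the length of `γ` for all `ξ` in
front of `γ`. The weights do not depend on the lift since the deck group is transitive on fibres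
(`ActsThrough.exists_smul_eq`).
-/

namespace SerreGraph

/-! ### Reduced paths and distances in a tree -/

section Tree

variable {V E : Type*} {G : SerreGraph V E}

theorem t_bar (e : E) : G.t (G.bar e) = G.o e := by rw [t, G.bar_bar]

theorem bar_inj {e f : E} : G.bar e = G.bar f ↔ e = f :=
  ⟨fun h => by rw [← G.bar_bar e, h, G.bar_bar], fun h => h ▸ rfl⟩

theorem vertex_o (e : E) : G.vertex (G.o e) = G.onEdge e 0 := (Quot.sound (Glue.zero e)).symm

theorem onEdge_bar (e : E) (s : unitInterval) :
    G.onEdge e s = G.onEdge (G.bar e) (unitInterval.symm s) := Quot.sound (Glue.flip e s)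

theorem isPath_append {u w : V} {l m : List E} :
    G.IsPath u (l ++ m) w ↔ ∃ v, G.IsPath u l v ∧ G.IsPath v m w := by
  induction l generalizing u with
  | nil => simp [IsPath]
  | cons e l ih => simp [IsPath, ih, and_assoc]

theorem IsReduced.tail {e : E} {l : List E} (h : G.IsReduced (e :: l)) : G.IsReduced l :=
  List.IsChain.tail h

theorem isReduced_cons_cons {e f : E} {l : List E} :
    G.IsReduced (e :: f :: l) ↔ (G.t e = G.o f ∧ f ≠ G.bar e) ∧ G.IsReduced (f :: l) :=
  List.isChain_cons_cons

theorem IsReduced.isPath {e : E} {l : List E} (h : G.IsReduced (e :: l)) :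
    G.IsPath (G.o e) (e :: l) (G.t ((e :: l).getLast (List.cons_ne_nil e l))) := by
  induction l generalizing e with
  | nil => exact ⟨rfl, rfl⟩
  | cons f l ih =>
    obtain ⟨h₁, h₂⟩ := isReduced_cons_cons.1 h
    refine ⟨rfl, ?_⟩
    rw [List.getLast_cons (List.cons_ne_nil f l), h₁.1]
    exact ih h₂

theorem IsTree.eq_of_isReduced (hG : G.IsTree) {u v : V} {l m : List E} (hl : G.IsPath u l v)
    (hl' : G.IsReduced l) (hm : G.IsPath u m v) (hm' : G.IsReduced m) : l = m :=
  (hG.2 u v).unique ⟨hl, hl'⟩ ⟨hm, hm'⟩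

/-- A nonempty reduced path in a tree is not closed. -/
theorem IsTree.o_ne_t (hG : G.IsTree) {e : E} {l : List E} (h : G.IsReduced (e :: l)) :
    G.o e ≠ G.t ((e :: l).getLast (List.cons_ne_nil e l)) := by
  intro h'
  have h₁ := h.isPath
  rw [← h'] at h₁
  exact List.cons_ne_nil e l (hG.eq_of_isReduced h₁ h (m := []) rfl List.isChain_nil)

/-- The reduced path from an edge of a tree to a vertex leaves the edge through its terminus or
through its origin. -/
theorem IsTree.isReduced_cons_or (hG : G.IsTree) (v : V) (e : E) :
    (∃ l, G.IsPath (G.t e) l v ∧ G.IsReduced (e :: l)) ∨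
      ∃ l, G.IsPath (G.o e) l v ∧ G.IsReduced (G.bar e :: l) := by
  obtain ⟨l, ⟨hl, hl'⟩, -⟩ := hG.2 (G.o e) v
  by_cases h : ∃ m, l = e :: m
  · obtain ⟨m, rfl⟩ := h
    exact Or.inl ⟨m, hl.2, hl'⟩
  · refine Or.inr ⟨l, hl, ?_⟩
    cases l with
    | nil => exact List.isChain_singleton _
    | cons f m =>
      refine isReduced_cons_cons.2 ⟨⟨?_, ?_⟩, hl'⟩
      · rw [t_bar, hl.1]
      · rw [G.bar_bar]
        rintro rfl
        exact h ⟨m, rfl⟩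

/-- The length of the reduced path from `u` to `v` in a tree. -/
noncomputable def pathLength (hG : G.IsTree) (ℓ : E → ℝ) (v u : V) : ℝ :=
  ((hG.2 u v).choose.map ℓ).sum

theorem pathLength_eq (hG : G.IsTree) (ℓ : E → ℝ) {v u : V} {l : List E} (hl : G.IsPath u l v)
    (hl' : G.IsReduced l) : pathLength hG ℓ v u = (l.map ℓ).sum := by
  rw [pathLength, (hG.2 u v).choose_spec.2 l ⟨hl, hl'⟩]

theorem pathLength_self (hG : G.IsTree) (ℓ : E → ℝ) (v : V) : pathLength hG ℓ v v = 0 := by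
  rw [pathLength_eq hG ℓ (l := []) rfl List.isChain_nil]; rfl

theorem abs_pathLength_sub_le (hG : G.IsTree) {ℓ : E → ℝ} (h0 : ∀ e, 0 ≤ ℓ e)
    (hbar : ∀ e, ℓ (G.bar e) = ℓ e) (v : V) (e : E) :
    |pathLength hG ℓ v (G.o e) - pathLength hG ℓ v (G.t e)| ≤ ℓ e := by
  rcases hG.isReduced_cons_or v e with ⟨l, hl, hl'⟩ | ⟨l, hl, hl'⟩
  · rw [pathLength_eq hG ℓ (u := G.o e) (l := e :: l) ⟨rfl, hl⟩ hl',
      pathLength_eq hG ℓ hl hl'.tail]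
    simp [abs_of_nonneg (h0 e)]
  · rw [pathLength_eq hG ℓ (u := G.t e) (l := G.bar e :: l) ⟨rfl, by rwa [t_bar]⟩ hl',
      pathLength_eq hG ℓ hl hl'.tail]
    simp [hbar, abs_of_nonneg (h0 e)]

/-- The distance from the vertex `v` of a tree, as a function on the geometric realization: the
length of the reduced path at vertices, interpolated linearly on edges. -/
noncomputable def vertexDist (hG : G.IsTree) (ℓ : E → ℝ) (v : V) : G.Point → ℝ :=
  Quot.lift (Sum.elim (pathLength hG ℓ v) fun p =>
    (1 - (p.2 : ℝ)) * pathLength hG ℓ v (G.o p.1) + p.2 * pathLength hG ℓ v (G.t p.1)) (by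
    rintro _ _ (⟨e⟩ | ⟨e, s⟩)
    · simp
    · simp only [Sum.elim_inr, unitInterval.coe_symm_eq, t_bar]
      rw [show G.o (G.bar e) = G.t e from rfl]
      ring)

theorem vertexDist_vertex (hG : G.IsTree) (ℓ : E → ℝ) (v u : V) :
    vertexDist hG ℓ v (G.vertex u) = pathLength hG ℓ v u := rfl

theorem vertexDist_onEdge (hG : G.IsTree) (ℓ : E → ℝ) (v : V) (e : E) (s : unitInterval) :
    vertexDist hG ℓ v (G.onEdge e s) =
      (1 - (s : ℝ)) * pathLength hG ℓ v (G.o e) + s * pathLength hG ℓ v (G.t e) := rfl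

section Lipschitz

variable (hG : G.IsTree) {ℓ : E → ℝ} (h0 : ∀ e, 0 ≤ ℓ e) (hbar : ∀ e, ℓ (G.bar e) = ℓ e)

include h0 hbar

theorem abs_vertexDist_sub_le_of_onEdge (v : V) (e : E) (s s' : unitInterval) :
    |vertexDist hG ℓ v (G.onEdge e s) - vertexDist hG ℓ v (G.onEdge e s')| ≤
      |(s : ℝ) - s'| * ℓ e := by
  have h : vertexDist hG ℓ v (G.onEdge e s) - vertexDist hG ℓ v (G.onEdge e s') =
      (s' - s) * (pathLength hG ℓ v (G.o e) - pathLength hG ℓ v (G.t e)) := by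
    rw [vertexDist_onEdge, vertexDist_onEdge]; ring
  rw [h, abs_mul, abs_sub_comm]
  exact mul_le_mul_of_nonneg_left (abs_pathLength_sub_le hG h0 hbar v e) (abs_nonneg _)

theorem abs_vertexDist_sub_le_of_tether (v : V) {x : G.Point} {u : V} {a : ℝ}
    (h : G.Tether ℓ x u a) : |vertexDist hG ℓ v x - vertexDist hG ℓ v (G.vertex u)| ≤ a := by
  rcases h with ⟨rfl, rfl⟩ | ⟨e, s, rfl, rfl, rfl⟩
  · simp
  · rw [vertex_o]
    refine (abs_vertexDist_sub_le_of_onEdge hG h0 hbar v e s 0).trans_eq ?_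
    simp [abs_of_nonneg s.2.1]

theorem abs_vertexDist_sub_le_of_isPath (v : V) {u w : V} {l : List E} (h : G.IsPath u l w) :
    |vertexDist hG ℓ v (G.vertex u) - vertexDist hG ℓ v (G.vertex w)| ≤ (l.map ℓ).sum := by
  induction l generalizing u with
  | nil => cases h; simp
  | cons e l ih =>
    obtain ⟨rfl, h⟩ := h
    have h₁ := abs_pathLength_sub_le hG h0 hbar v e
    have h₂ := ih h
    simp only [vertexDist_vertex, List.map_cons, List.sum_cons] at h₂ ⊢
    exact (abs_sub_le _ _ _).trans (add_le_add h₁ h₂)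

omit h0 hbar in
theorem exists_tether (ℓ : E → ℝ) (x : G.Point) : ∃ u a, G.Tether ℓ x u a := by
  rcases x with ⟨v | ⟨e, s⟩⟩
  · exact ⟨v, 0, Or.inl ⟨rfl, rfl⟩⟩
  · exact ⟨G.o e, s * ℓ e, Or.inr ⟨e, s, rfl, rfl, rfl⟩⟩

/-- The distance from a vertex is `1`-Lipschitz; this is the only lower bound for `dist` that the
geometry of the tree requires. -/
theorem abs_vertexDist_sub_le (v : V) (x y : G.Point) :
    |vertexDist hG ℓ v x - vertexDist hG ℓ v y| ≤ G.dist ℓ x y := by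
  refine le_csInf ?_ ?_
  · obtain ⟨u, a, hu⟩ := exists_tether ℓ x
    obtain ⟨w, c, hw⟩ := exists_tether ℓ y
    obtain ⟨l, ⟨hl, -⟩, -⟩ := hG.2 u w
    exact ⟨_, Or.inl ⟨u, w, a, c, l, hu, hw, hl, rfl⟩⟩
  · rintro r (⟨u, w, a, c, l, hu, hw, hl, rfl⟩ | ⟨e, s, s', rfl, rfl, rfl⟩)
    · have h₁ := abs_le.1 (abs_vertexDist_sub_le_of_tether hG h0 hbar v hu)
      have h₂ := abs_le.1 (abs_vertexDist_sub_le_of_tether hG h0 hbar v hw)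
      have h₃ := abs_le.1 (abs_vertexDist_sub_le_of_isPath hG h0 hbar v hl)
      rw [abs_le]
      constructor <;> linarith
    · exact abs_vertexDist_sub_le_of_onEdge hG h0 hbar v e s s'

omit hbar in
theorem tether_nonneg {x : G.Point} {u : V} {a : ℝ} (h : G.Tether ℓ x u a) : 0 ≤ a := by
  rcases h with ⟨-, rfl⟩ | ⟨e, s, -, -, rfl⟩
  · exact le_rfl
  · exact mul_nonneg s.2.1 (h0 e)

omit hbar in
theorem bddBelow_dist (x y : G.Point) :
    BddBelow {r : ℝ |
      (∃ (u v : V) (a c : ℝ) (l : List E), G.Tether ℓ x u a ∧ G.Tether ℓ y v c ∧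
        G.IsPath u l v ∧ r = a + (l.map ℓ).sum + c) ∨
      ∃ (e : E) (s s' : unitInterval), x = G.onEdge e s ∧ y = G.onEdge e s' ∧
        r = |(s : ℝ) - s'| * ℓ e} := by
  refine ⟨0, ?_⟩
  rintro r (⟨u, w, a, c, l, hu, hw, hl, rfl⟩ | ⟨e, s, s', rfl, rfl, rfl⟩)
  · have h₁ := tether_nonneg h0 hu
    have h₂ := tether_nonneg h0 hw
    have h₃ : 0 ≤ (l.map ℓ).sum := List.sum_nonneg (by simpa using fun e _ => h0 e)
    positivity
  · exact mul_nonneg (abs_nonneg _) (h0 e)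

omit hbar in
theorem dist_le_of_tether {x y : G.Point} {u w : V} {a c : ℝ} {l : List E}
    (hu : G.Tether ℓ x u a) (hw : G.Tether ℓ y w c) (hl : G.IsPath u l w) :
    G.dist ℓ x y ≤ a + (l.map ℓ).sum + c :=
  csInf_le (bddBelow_dist h0 x y) (Or.inl ⟨u, w, a, c, l, hu, hw, hl, rfl⟩)

include hG in
theorem dist_nonneg (x y : G.Point) : 0 ≤ G.dist ℓ x y := by
  obtain ⟨v⟩ := hG.1
  exact (abs_nonneg _).trans (abs_vertexDist_sub_le hG h0 hbar v x y)

include hG in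
theorem dist_onEdge_self (e : E) (s : unitInterval) :
    G.dist ℓ (G.onEdge e s) (G.onEdge e s) = 0 :=
  le_antisymm (csInf_le (bddBelow_dist h0 _ _) (Or.inr ⟨e, s, s, rfl, rfl, by simp⟩))
    (dist_nonneg hG h0 hbar _ _)

omit h0 in
theorem dist_symm (x y : G.Point) : G.dist ℓ x y = G.dist ℓ y x := by
  have hsum (l : List E) : ((G.rev l).map ℓ).sum = (l.map ℓ).sum := by
    rw [rev, List.map_reverse, List.sum_reverse, List.map_map]
    congr 2
    exact funext hbar
  unfold dist
  congr 1
  ext r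
  constructor <;>
  · rintro (⟨u, w, a, c, l, hu, hw, hl, rfl⟩ | ⟨e, s, s', rfl, rfl, rfl⟩)
    · exact Or.inl ⟨w, u, c, a, G.rev l, hw, hu, hl.rev, by rw [hsum]; ring⟩
    · exact Or.inr ⟨e, s', s, rfl, rfl, by rw [abs_sub_comm]⟩

theorem dist_vertex (x : G.Point) (v : V) :
    G.dist ℓ x (G.vertex v) = vertexDist hG ℓ v x := by
  have hv : G.Tether ℓ (G.vertex v) v 0 := Or.inl ⟨rfl, rfl⟩
  apply le_antisymm
  · rcases x with ⟨u | ⟨e, s⟩⟩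
    · obtain ⟨l, ⟨hl, hl'⟩, -⟩ := hG.2 u v
      refine (dist_le_of_tether h0 (Or.inl ⟨rfl, rfl⟩) hv hl).trans_eq ?_
      rw [zero_add, add_zero, ← pathLength_eq hG ℓ hl hl']
      rfl
    · rcases hG.isReduced_cons_or v e with ⟨l, hl, hl'⟩ | ⟨l, hl, hl'⟩
      · refine (dist_le_of_tether h0 (Or.inr ⟨G.bar e, unitInterval.symm s,
          onEdge_bar e s, rfl, rfl⟩) hv hl).trans_eq ?_
        refine Eq.trans ?_ (vertexDist_onEdge hG ℓ v e s).symm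
        rw [pathLength_eq hG ℓ (u := G.o e) (l := e :: l) ⟨rfl, hl⟩ hl',
          pathLength_eq hG ℓ hl hl'.tail, hbar, unitInterval.coe_symm_eq, List.map_cons,
          List.sum_cons]
        ring
      · refine (dist_le_of_tether h0 (Or.inr ⟨e, s, rfl, rfl, rfl⟩) hv hl).trans_eq ?_
        refine Eq.trans ?_ (vertexDist_onEdge hG ℓ v e s).symm
        rw [pathLength_eq hG ℓ (u := G.t e) (l := G.bar e :: l) ⟨rfl, by rwa [t_bar]⟩ hl',
          pathLength_eq hG ℓ hl hl'.tail, List.map_cons, List.sum_cons, hbar]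
        ring
  · refine le_trans ?_ ((le_abs_self _).trans (abs_vertexDist_sub_le hG h0 hbar v x _))
    rw [vertexDist_vertex, pathLength_self, sub_zero]

include hG in
/-- The distance between points on the first and the last edge of a reduced path. The lower bound
compares the distances from the terminus of the path. -/
theorem dist_of_isReduced {e f : E} {l : List E} (h : G.IsReduced (e :: (l ++ [f])))
    (s s' : unitInterval) :
    G.dist ℓ (G.onEdge e s) (G.onEdge f s') = (1 - s) * ℓ e + (l.map ℓ).sum + s' * ℓ f := by
  have hp := h.isPath
  simp only [List.getLast_cons (List.append_ne_nil_of_right_ne_nil l (List.cons_ne_nil f [])),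
    List.getLast_append_singleton] at hp
  obtain ⟨w, hw, hf⟩ := isPath_append.1 hp.2
  obtain rfl : G.o f = w := hf.1
  apply le_antisymm
  · refine dist_le_of_tether h0 (Or.inr ⟨G.bar e, unitInterval.symm s, onEdge_bar e s, rfl, ?_⟩)
      (Or.inr ⟨f, s', rfl, rfl, rfl⟩) hw
    rw [unitInterval.coe_symm_eq, hbar]
  · refine le_trans (le_of_eq ?_)
      ((le_abs_self _).trans (abs_vertexDist_sub_le hG h0 hbar (G.t f) _ _))
    have hf' : G.IsReduced [f] := List.isChain_singleton f
    rw [vertexDist_onEdge, vertexDist_onEdge, pathLength_self, pathLength_eq hG ℓ hf hf',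
      pathLength_eq hG ℓ hp h, pathLength_eq hG ℓ hp.2 h.tail]
    simp
    ring

end Lipschitz

end Tree

/-! ### Rays -/

section Rays

variable {V E : Type*} {G : SerreGraph V E}

/-- The ray with its first `n` edges removed. -/
def Ray.drop (r : G.Ray) (n : ℕ) : G.Ray := ⟨fun k => r.1 (n + k), fun k => r.2 (n + k)⟩

/-- The ray with one more edge in front. -/
def Ray.cons (e : E) (r : G.Ray) (h : G.t e = G.o (r.1 0) ∧ r.1 0 ≠ G.bar e) : G.Ray :=
  ⟨fun k => Nat.casesOn k e r.1, fun k => by cases k with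
    | zero => exact h
    | succ k => exact r.2 k⟩

theorem Ray.toEnd_eq_iff {r r' : G.Ray} :
    r.toEnd = r'.toEnd ↔ ∃ m n : ℕ, ∀ k, r.1 (m + k) = r'.1 (n + k) :=
  Quotient.eq (r := G.cofinal)

theorem Ray.toEnd_drop (r : G.Ray) (n : ℕ) : (r.drop n).toEnd = r.toEnd :=
  Ray.toEnd_eq_iff.2 ⟨0, n, fun k => by simp [Ray.drop]⟩

theorem Ray.toEnd_cons {e : E} {r : G.Ray} (h : G.t e = G.o (r.1 0) ∧ r.1 0 ≠ G.bar e) :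
    (Ray.cons e r h).toEnd = r.toEnd :=
  Ray.toEnd_eq_iff.2 ⟨1, 0, fun k => by rw [Nat.add_comm 1 k, Nat.zero_add]; rfl⟩

theorem Ray.exists_append (l : List E) (r : G.Ray) (h : G.IsReduced (l ++ [r.1 0])) :
    ∃ R : G.Ray, (∀ (i : ℕ) (hi : i < l.length), R.1 i = l[i]) ∧
      ∀ k, R.1 (l.length + k) = r.1 k := by
  induction l with
  | nil => exact ⟨r, by simp, by simp⟩
  | cons e l ih =>
    obtain ⟨R, h₁, h₂⟩ := ih h.tail
    have h' : G.t e = G.o (R.1 0) ∧ R.1 0 ≠ G.bar e := by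
      cases l with
      | nil =>
        rw [show R.1 0 = r.1 0 from h₂ 0]
        exact (isReduced_cons_cons.1 h).1
      | cons f l =>
        rw [h₁ 0 (by simp)]
        exact (isReduced_cons_cons.1 h).1
    refine ⟨Ray.cons e R h', ?_, fun k => ?_⟩
    · rintro (_ | i) hi
      · rfl
      · exact h₁ i (by simpa using hi)
    · rw [List.length_cons, Nat.add_right_comm]
      exact h₂ k

theorem mem_cyl_singleton {ξ : G.Boundary} {e : E} :
    ξ ∈ G.cyl [e] ↔ ∃ r : G.Ray, r.toEnd = ξ ∧ r.1 0 = e := by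
  simp [cyl]

theorem Ray.toEnd_mem_cyl (r : G.Ray) (n : ℕ) : r.toEnd ∈ G.cyl [r.1 n] :=
  mem_cyl_singleton.2 ⟨r.drop n, r.toEnd_drop n, rfl⟩

theorem exists_toEnd (ξ : G.Boundary) : ∃ r : G.Ray, r.toEnd = ξ := Quotient.exists_rep ξ

/-- A ray can be moved back along an edge, by prepending the edge or deleting a back-tracking. -/
theorem Ray.exists_of_isPath {u v : V} {l : List E} (hl : G.IsPath u l v) (r : G.Ray)
    (hr : G.o (r.1 0) = v) : ∃ R : G.Ray, R.toEnd = r.toEnd ∧ G.o (R.1 0) = u := by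
  induction l generalizing u with
  | nil => cases hl; exact ⟨r, rfl, hr⟩
  | cons e l ih =>
    obtain ⟨rfl, hl⟩ := hl
    obtain ⟨R, hR, hR'⟩ := ih hl
    by_cases h : R.1 0 = G.bar e
    · refine ⟨R.drop 1, (R.toEnd_drop 1).trans hR, ?_⟩
      have := (R.2 0).1
      rw [h, t_bar] at this
      exact this.symm
    · exact ⟨Ray.cons e R ⟨hR'.symm, h⟩, (Ray.toEnd_cons _).trans hR, rfl⟩

theorem IsTree.exists_ray (hG : G.IsTree) (v : V) (ξ : G.Boundary) :
    ∃ r : G.Ray, r.toEnd = ξ ∧ G.o (r.1 0) = v := by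
  obtain ⟨r, rfl⟩ := exists_toEnd ξ
  obtain ⟨l, ⟨hl, -⟩, -⟩ := hG.2 v (G.o (r.1 0))
  exact Ray.exists_of_isPath hl r rfl

theorem Ray.isReduced_append (r : G.Ray) (i k : ℕ) (l : List E)
    (h : G.IsReduced (r.1 (i + k) :: l)) :
    G.IsReduced ((List.range' i k).map r.1 ++ r.1 (i + k) :: l) := by
  induction k generalizing l with
  | zero => simpa using h
  | succ k ih =>
    rw [List.range'_concat, List.map_append, List.append_assoc]
    simp only [one_mul, List.map_cons, List.map_nil, List.cons_append, List.nil_append]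
    exact ih _ (isReduced_cons_cons.2 ⟨r.2 (i + k), h⟩)

/-- The signed length of a ray from its origin to the point at fraction `s` of its `i`-th edge. -/
noncomputable def Ray.pos (ℓ : E → ℝ) (r : G.Ray) (i : ℕ) (s : ℝ) : ℝ :=
  ∑ k ∈ Finset.range i, ℓ (r.1 k) + s * ℓ (r.1 i)

theorem sum_map_range' (f : ℕ → ℝ) (i k : ℕ) :
    ((List.range' i k).map f).sum =
      ∑ j ∈ Finset.range (i + k), f j - ∑ j ∈ Finset.range i, f j := by
  induction k with
  | zero => simp
  | succ k ih =>
    rw [List.range'_concat, List.map_append, List.sum_append, ih, ← Nat.add_assoc,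
      Finset.sum_range_succ]
    simp
    ring

section Dist

variable (hG : G.IsTree) {ℓ : E → ℝ} (h0 : ∀ e, 0 ≤ ℓ e) (hbar : ∀ e, ℓ (G.bar e) = ℓ e)

include hG h0 hbar

/-- The distance from a point of a ray to a point in the shadow of a later edge of the ray: the
second summand does not depend on the ray. -/
theorem Ray.dist_shadow (r : G.Ray) {i n : ℕ} (hin : i < n) {l : List E}
    (h : G.IsReduced (r.1 n :: l)) (s s' : unitInterval) :
    G.dist ℓ (G.onEdge (r.1 i) s)
        (G.onEdge ((r.1 n :: l).getLast (List.cons_ne_nil _ l)) s') =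
      (r.pos ℓ n 0 - r.pos ℓ i s) + (((r.1 n :: l).dropLast.map ℓ).sum +
        s' * ℓ ((r.1 n :: l).getLast (List.cons_ne_nil _ l))) := by
  obtain ⟨k, rfl⟩ := Nat.exists_eq_add_of_lt hin
  have h₁ := r.isReduced_append i (k + 1) l h
  rw [List.range'_succ, List.map_cons, List.cons_append, ← Nat.add_assoc,
    ← List.dropLast_append_getLast (List.cons_ne_nil (r.1 (i + k + 1)) l), ← List.append_assoc]
    at h₁
  rw [dist_of_isReduced hG h0 hbar h₁, List.map_append, List.map_map, List.sum_append,
    sum_map_range', Nat.add_right_comm, Ray.pos, Ray.pos, Finset.sum_range_succ _ i]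
  simp only [Function.comp]
  ring

theorem Ray.dist_eq_pos_sub (r : G.Ray) {i j : ℕ} (hij : i < j) (s s' : unitInterval) :
    G.dist ℓ (G.onEdge (r.1 i) s) (G.onEdge (r.1 j) s') = r.pos ℓ j s' - r.pos ℓ i s := by
  refine (r.dist_shadow hG h0 hbar hij (l := []) (List.isChain_singleton _) s s').trans ?_
  simp [Ray.pos]
  ring

end Dist

end Rays

/-! ### Busemann functions -/

section Busemann

variable {V E : Type*} {G : SerreGraph V E}

theorem Ray.shadow_subset (r : G.Ray) (m n : ℕ) :
    G.shadow (r.1 (m + n)) ⊆ G.shadow (r.1 m) := by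
  rintro _ ⟨l, s, hl, rfl⟩
  have h := r.isReduced_append m n l hl
  cases n with
  | zero => exact ⟨l, s, hl, rfl⟩
  | succ n =>
    rw [List.range'_succ, List.map_cons, List.cons_append] at h
    refine ⟨_, s, h, ?_⟩
    congr 1
    rw [List.getLast_cons (List.append_ne_nil_of_right_ne_nil _ (List.cons_ne_nil _ l)),
      List.getLast_append_of_ne_nil _ (List.cons_ne_nil _ l)]

theorem hasBasis_atEnd (ξ : G.Boundary) :
    (G.atEnd ξ).HasBasis (fun e => ξ ∈ G.cyl [e]) G.shadow := by
  refine hasBasis_biInf_principal ?_ ?_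
  · intro e he e' he'
    obtain ⟨r, rfl, rfl⟩ := mem_cyl_singleton.1 he
    obtain ⟨r', h, rfl⟩ := mem_cyl_singleton.1 he'
    obtain ⟨m, n, hmn⟩ := Ray.toEnd_eq_iff.1 h
    refine ⟨r'.1 m, h ▸ r'.toEnd_mem_cyl m, ?_, ?_⟩
    · have := r.shadow_subset 0 n
      rwa [Nat.zero_add, ← Nat.add_zero n, ← hmn 0] at this
    · have := r'.shadow_subset 0 m
      rwa [Nat.zero_add] at this
  · obtain ⟨r, rfl⟩ := exists_toEnd ξ
    exact ⟨r.1 0, r.toEnd_mem_cyl 0⟩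

theorem Ray.eventually_onEdge_mem (r : G.Ray) {S : Set G.Point} (hS : S ∈ G.atEnd r.toEnd) :
    ∀ᶠ n in atTop, ∀ s, G.onEdge (r.1 n) s ∈ S := by
  obtain ⟨e, he, heS⟩ := (hasBasis_atEnd r.toEnd).mem_iff.1 hS
  obtain ⟨ρ, hρ, rfl⟩ := mem_cyl_singleton.1 he
  obtain ⟨m, n, h⟩ := Ray.toEnd_eq_iff.1 hρ
  filter_upwards [eventually_ge_atTop n] with N hN s
  obtain ⟨k, rfl⟩ := Nat.exists_eq_add_of_le hN
  rw [← h k]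
  have h₁ := ρ.shadow_subset 0 (m + k)
  rw [Nat.zero_add] at h₁
  exact heS (h₁ ⟨[], s, List.isChain_singleton _, rfl⟩)

/-- Busemann functions can be evaluated at vertices. -/
theorem exists_vertex_of_mem_atEnd {ξ : G.Boundary} {S : Set G.Point} (hS : S ∈ G.atEnd ξ) :
    ∃ v, G.vertex v ∈ S := by
  obtain ⟨r, rfl⟩ := exists_toEnd ξ
  obtain ⟨n, hn⟩ := (r.eventually_onEdge_mem hS).exists
  exact ⟨G.o (r.1 n), vertex_o (G := G) (r.1 n) ▸ hn 0⟩

instance atEnd_neBot (ξ : G.Boundary) : (G.atEnd ξ).NeBot :=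
  neBot_iff.2 fun h => by
    obtain ⟨v, hv⟩ := exists_vertex_of_mem_atEnd (ξ := ξ) (S := ∅) (by rw [h]; trivial)
    exact hv

/-- Any point of a tree lies on the first edge of a ray to a given end. -/
theorem IsTree.exists_ray_onEdge (hG : G.IsTree) (x : G.Point) (ξ : G.Boundary) :
    ∃ (r : G.Ray) (s : unitInterval), r.toEnd = ξ ∧ x = G.onEdge (r.1 0) s := by
  rcases x with ⟨v | ⟨e, s⟩⟩
  · obtain ⟨r, hr, rfl⟩ := hG.exists_ray v ξ
    exact ⟨r, 0, hr, vertex_o _⟩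
  · obtain ⟨r, hr, hv⟩ := hG.exists_ray (G.o e) ξ
    by_cases h : r.1 0 = e
    · exact ⟨r, s, hr, by rw [h]; rfl⟩
    · refine ⟨Ray.cons (G.bar e) r ⟨by rw [t_bar, hv], by rwa [G.bar_bar]⟩,
        unitInterval.symm s, by rw [Ray.toEnd_cons, hr], onEdge_bar e s⟩

section

variable (hG : G.IsTree) {ℓ : E → ℝ} (h0 : ∀ e, 0 ≤ ℓ e) (hbar : ∀ e, ℓ (G.bar e) = ℓ e)

include hG h0 hbar

theorem eventually_dist_sub_of_ray {r r' : G.Ray} {i j n m : ℕ} (hi : i < n) (hj : j < m)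
    (h : r.1 n = r'.1 m) (s s' : unitInterval) {ξ : G.Boundary} (hξ : ξ ∈ G.cyl [r.1 n]) :
    ∀ᶠ u in G.atEnd ξ, G.dist ℓ (G.onEdge (r.1 i) s) u - G.dist ℓ (G.onEdge (r'.1 j) s') u =
      (r.pos ℓ n 0 - r.pos ℓ i s) - (r'.pos ℓ m 0 - r'.pos ℓ j s') := by
  refine (hasBasis_atEnd ξ).mem_iff.2 ⟨_, hξ, ?_⟩
  rintro _ ⟨l, a, hl, rfl⟩
  show _ - _ = _
  rw [r.dist_shadow hG h0 hbar hi hl]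
  have h₂ := r'.dist_shadow hG h0 hbar hj (l := l) (by rwa [← h]) s' a
  simp only [← h] at h₂
  rw [h₂]
  ring

omit hG h0 hbar in
theorem busemann_eq_of_eventually {ξ : G.Boundary} {x y : G.Point} {c : ℝ}
    (h : ∀ᶠ u in G.atEnd ξ, G.dist ℓ x u - G.dist ℓ y u = c) : G.busemann ℓ ξ x y = c :=
  Tendsto.limUnder_eq (tendsto_const_nhds.congr' (h.mono fun _ hu => hu.symm))

/-- For all `ξ'` near the end `ξ`, the differences whose limit is `B_ξ'(x, y)` are eventually
constant, with a value independent of `ξ'`. -/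
theorem exists_cyl_eventually_dist_sub (ξ : G.Boundary) (x y : G.Point) :
    ∃ (e : E) (c : ℝ), ξ ∈ G.cyl [e] ∧
      ∀ ξ' ∈ G.cyl [e], ∀ᶠ u in G.atEnd ξ', G.dist ℓ x u - G.dist ℓ y u = c := by
  obtain ⟨r, s, rfl, rfl⟩ := hG.exists_ray_onEdge x ξ
  obtain ⟨r', s', h, rfl⟩ := hG.exists_ray_onEdge y r.toEnd
  obtain ⟨m, n, hmn⟩ := Ray.toEnd_eq_iff.1 h
  exact ⟨r.1 (n + 1), _, r.toEnd_mem_cyl _, fun ξ' hξ' =>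
    eventually_dist_sub_of_ray hG h0 hbar n.succ_pos m.succ_pos (hmn 1).symm s s' hξ'⟩

theorem eventually_busemann (ξ : G.Boundary) (x y : G.Point) :
    ∀ᶠ u in G.atEnd ξ, G.dist ℓ x u - G.dist ℓ y u = G.busemann ℓ ξ x y := by
  obtain ⟨e, c, hξ, h⟩ := exists_cyl_eventually_dist_sub hG h0 hbar ξ x y
  rw [busemann_eq_of_eventually (h ξ hξ)]
  exact h ξ hξ

theorem exists_cyl_busemann_eq (ξ : G.Boundary) (x y : G.Point) :
    ∃ e : E, ξ ∈ G.cyl [e] ∧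
      ∀ ξ' ∈ G.cyl [e], G.busemann ℓ ξ' x y = G.busemann ℓ ξ x y := by
  obtain ⟨e, c, hξ, h⟩ := exists_cyl_eventually_dist_sub hG h0 hbar ξ x y
  refine ⟨e, hξ, fun ξ' hξ' => ?_⟩
  rw [busemann_eq_of_eventually (h ξ hξ), busemann_eq_of_eventually (h ξ' hξ')]

theorem busemann_add (ξ : G.Boundary) (x y z : G.Point) :
    G.busemann ℓ ξ x y + G.busemann ℓ ξ y z = G.busemann ℓ ξ x z := by
  refine (busemann_eq_of_eventually ?_).symm
  filter_upwards [eventually_busemann hG h0 hbar ξ x y, eventually_busemann hG h0 hbar ξ y z]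
    with u h₁ h₂
  rw [← h₁, ← h₂]
  ring

theorem abs_busemann_le (ξ : G.Boundary) (x y : G.Point) :
    |G.busemann ℓ ξ x y| ≤ G.dist ℓ x y := by
  obtain ⟨v, hv⟩ := exists_vertex_of_mem_atEnd (eventually_busemann hG h0 hbar ξ x y)
  have hv' : G.dist ℓ x (G.vertex v) - G.dist ℓ y (G.vertex v) = G.busemann ℓ ξ x y := hv
  rw [← hv', dist_vertex hG h0 hbar, dist_vertex hG h0 hbar]
  exact abs_vertexDist_sub_le hG h0 hbar v x y

end

end Busemann

/-! ### Lines and the distance to a line -/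

section Lines

variable {V E : Type*} {G : SerreGraph V E}

/-- A bi-infinite edge-path without back-tracking. -/
def IsBiinfinite (G : SerreGraph V E) (c : ℤ → E) : Prop :=
  ∀ n, G.t (c n) = G.o (c (n + 1)) ∧ c (n + 1) ≠ G.bar (c n)

/-- The positive half of a bi-infinite path, starting with the edge of index `a`. -/
def IsBiinfinite.forward {c : ℤ → E} (hc : G.IsBiinfinite c) (a : ℤ) : G.Ray :=
  ⟨fun k => c (a + k), fun k => by
    have := hc (a + k)
    rwa [add_assoc] at this⟩

theorem IsBiinfinite.reverse {c : ℤ → E} (hc : G.IsBiinfinite c) :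
    G.IsBiinfinite fun n => G.bar (c (-1 - n)) := by
  intro n
  obtain ⟨h₁, h₂⟩ := hc (-1 - (n + 1))
  rw [show -1 - (n + 1) + 1 = -1 - n by ring] at h₁ h₂
  refine ⟨?_, ?_⟩
  · rw [t_bar]; exact h₁.symm
  · rw [G.bar_bar]; exact fun h => h₂ h.symm

theorem IsBiinfinite.toEnd_forward {c : ℤ → E} (hc : G.IsBiinfinite c) (a b : ℤ) :
    (hc.forward a).toEnd = (hc.forward b).toEnd :=
  Ray.toEnd_eq_iff.2 ⟨(b - a).toNat, (a - b).toNat, fun k => by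
    simp only [forward]
    congr 1
    omega⟩

theorem isLine_iff {c : ℤ → E} {ξ ζ : G.Boundary} :
    G.IsLine c ξ ζ ↔ ∃ hc : G.IsBiinfinite c,
      (hc.reverse.forward 0).toEnd = ξ ∧ (hc.forward 0).toEnd = ζ := by
  constructor
  · rintro ⟨hc, r, r', rfl, rfl, h⟩
    refine ⟨hc, congrArg Ray.toEnd (Subtype.ext (funext fun n => ?_)),
      congrArg Ray.toEnd (Subtype.ext (funext fun n => ?_))⟩
    · simp [IsBiinfinite.forward, (h n).1]
    · simp [IsBiinfinite.forward, (h n).2]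
  · rintro ⟨hc, rfl, rfl⟩
    exact ⟨hc, _, _, rfl, rfl, fun n => by simp [IsBiinfinite.forward]⟩

theorem IsLine.reverse {c : ℤ → E} {ξ ζ : G.Boundary} (h : G.IsLine c ξ ζ) :
    G.IsLine (fun n => G.bar (c (-1 - n))) ζ ξ := by
  obtain ⟨hc, rfl, rfl⟩ := isLine_iff.1 h
  refine isLine_iff.2 ⟨hc.reverse, ?_, rfl⟩
  refine congrArg Ray.toEnd (Subtype.ext (funext fun n => ?_))
  simp [IsBiinfinite.forward, G.bar_bar]

theorem line_symm (ξ ζ : G.Boundary) : G.line ξ ζ = G.line ζ ξ := by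
  have h (ξ ζ : G.Boundary) : G.line ξ ζ ⊆ G.line ζ ξ := by
    rintro _ ⟨c, n, s, hc, rfl⟩
    refine ⟨_, -1 - n, unitInterval.symm s, hc.reverse, ?_⟩
    rw [onEdge_bar]
    simp
  exact (h ξ ζ).antisymm (h ζ ξ)

/-- Two rays that leave a vertex through different edges form a line. -/
theorem exists_isLine_of_rays {r r' : G.Ray} (ho : G.o (r.1 0) = G.o (r'.1 0))
    (hne : r.1 0 ≠ r'.1 0) : ∃ c, G.IsLine c r.toEnd r'.toEnd ∧
      ∀ n : ℕ, r.1 n = G.bar (c (-1 - n)) ∧ r'.1 n = c n := by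
  let c : ℤ → E := fun n => Int.rec (fun k => r'.1 k) (fun k => G.bar (r.1 k)) n
  have h₁ (n : ℕ) : c n = r'.1 n := rfl
  have h₂ (n : ℕ) : c (-1 - n) = G.bar (r.1 n) := by
    rw [show (-1 - n : ℤ) = Int.negSucc n by omega]
  have key (n : ℕ) : r.1 n = G.bar (c (-1 - n)) ∧ r'.1 n = c n := by
    rw [h₁, h₂, G.bar_bar]
    exact ⟨rfl, rfl⟩
  refine ⟨c, ⟨?_, r, r', rfl, rfl, key⟩, key⟩
  rintro (n | _ | n)
  · exact r'.2 n
  · show G.t (G.bar (r.1 0)) = G.o (r'.1 0) ∧ r'.1 0 ≠ G.bar (G.bar (r.1 0))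
    rw [t_bar, G.bar_bar]
    exact ⟨ho, hne.symm⟩
  · show G.t (G.bar (r.1 (n + 1))) = G.o (G.bar (r.1 n)) ∧
      G.bar (r.1 n) ≠ G.bar (G.bar (r.1 (n + 1)))
    rw [t_bar, G.bar_bar]
    exact ⟨(r.2 n).1.symm, fun h => (r.2 n).2 h.symm⟩

/-- In a tree, rays that leave a vertex through different edges have different ends. -/
theorem IsTree.toEnd_ne (hG : G.IsTree) {r r' : G.Ray} (ho : G.o (r.1 0) = G.o (r'.1 0))
    (hne : r.1 0 ≠ r'.1 0) : r.toEnd ≠ r'.toEnd := by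
  intro h
  obtain ⟨m, n, hmn⟩ := Ray.toEnd_eq_iff.1 h
  obtain ⟨c, hc, hcr⟩ := exists_isLine_of_rays ho hne
  obtain ⟨hc, -, -⟩ := isLine_iff.1 hc
  -- A common edge of the two rays closes up a segment of the line formed by them.
  have h₁ := (hc.forward (-1 - m)).isReduced_append 0 (m + n + 1) [] (List.isChain_singleton _)
  rw [List.range'_succ, List.map_cons, List.cons_append] at h₁
  refine hG.o_ne_t h₁ ?_
  rw [List.getLast_cons (List.append_ne_nil_of_right_ne_nil _ (List.cons_ne_nil _ [])),
    List.getLast_append_singleton]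
  have h₂ := hmn 0
  rw [Nat.add_zero, Nat.add_zero, (hcr m).1, (hcr n).2] at h₂
  simp only [IsBiinfinite.forward]
  rw [show (-1 - m + ((0 + (m + n + 1) : ℕ) : ℤ) : ℤ) = n by push_cast; ring, ← h₂, t_bar]
  simp

/-- A geodesic contains a reduced path if and only if it comes from behind the first edge and goes
to an end in front of the last edge. -/
theorem mem_cyl₂_iff {γ : List E} (hne : γ ≠ []) (hγ : G.IsReduced γ)
    (q : G.Boundary₂) :
    q ∈ G.cyl₂ γ ↔ q.1.1 ∈ G.cyl [G.bar (γ.head hne)] ∧ q.1.2 ∈ G.cyl [γ.getLast hne] := by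
  constructor
  · rintro ⟨c, n, hc, h⟩
    obtain ⟨hc, h₁, h₂⟩ := isLine_iff.1 hc
    have hlen := List.length_pos_of_ne_nil hne
    rw [← h₁, ← h₂, hc.toEnd_forward 0 (n + (γ.length - 1 : ℕ)),
      hc.reverse.toEnd_forward 0 (-1 - n)]
    constructor
    · refine mem_cyl_singleton.2 ⟨_, rfl, ?_⟩
      simp only [IsBiinfinite.forward]
      rw [List.head_eq_getElem, ← h 0 hlen]
      simp
    · refine mem_cyl_singleton.2 ⟨_, rfl, ?_⟩
      simp only [IsBiinfinite.forward]
      rw [List.getLast_eq_getElem, ← h (γ.length - 1) (by omega)]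
      simp
  · rintro ⟨h₁, h₂⟩
    obtain ⟨r, hr, hr0⟩ := mem_cyl_singleton.1 h₁
    obtain ⟨r', hr', hr0'⟩ := mem_cyl_singleton.1 h₂
    have hsplit := List.dropLast_append_getLast hne
    obtain ⟨R, hR, hR'⟩ := Ray.exists_append γ.dropLast r' (by rwa [hr0', hsplit])
    have hRγ (i : ℕ) (hi : i < γ.length) : R.1 i = γ[i] := by
      by_cases hi' : i < γ.dropLast.length
      · rw [hR i hi', List.getElem_dropLast]
      · rw [List.length_dropLast] at hi'
        have hi'' : i = γ.length - 1 := by omega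
        have := hR' 0
        rw [List.length_dropLast, Nat.add_zero, hr0', List.getLast_eq_getElem] at this
        subst hi''
        exact this
    have hlen := List.length_pos_of_ne_nil hne
    have hR0 : R.1 0 = γ.head hne := by rw [hRγ 0 hlen, List.head_eq_getElem]
    obtain ⟨hr1, hr2⟩ := r.2 0
    rw [hr0, t_bar] at hr1
    rw [hr0, G.bar_bar] at hr2
    obtain ⟨c, hc, hc'⟩ := exists_isLine_of_rays (r := r.drop 1) (r' := R)
      (by rw [hR0]; exact hr1.symm) (by rw [hR0]; exact hr2)
    have hRe : R.toEnd = r'.toEnd :=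
      Ray.toEnd_eq_iff.2 ⟨γ.dropLast.length, 0, fun k => by rw [hR', Nat.zero_add]⟩
    rw [Ray.toEnd_drop, hr, hRe, hr'] at hc
    refine ⟨c, 0, hc, fun i hi => ?_⟩
    rw [zero_add, ← (hc' i).2, hRγ i hi]

theorem IsTree.disjoint_cyl (hG : G.IsTree) {e f : E} (ho : G.o e = G.o f) (hne : e ≠ f) :
    Disjoint (G.cyl [e]) (G.cyl [f]) := by
  rw [Set.disjoint_left]
  intro ξ h₁ h₂
  obtain ⟨r, hr, rfl⟩ := mem_cyl_singleton.1 h₁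
  obtain ⟨r', hr', rfl⟩ := mem_cyl_singleton.1 h₂
  exact hG.toEnd_ne ho hne (hr.trans hr'.symm)

/-- In a tree, the ends in front of a reduced path are not behind it. -/
theorem IsTree.disjoint_cyl_of_isReduced (hG : G.IsTree) {γ : List E} (hne : γ ≠ [])
    (hγ : G.IsReduced γ) : Disjoint (G.cyl [G.bar (γ.head hne)]) (G.cyl [γ.getLast hne]) := by
  rw [Set.disjoint_left]
  intro ξ h₁ h₂
  obtain ⟨r, hr, hr0⟩ := mem_cyl_singleton.1 h₁
  obtain ⟨r', hr', hr0'⟩ := mem_cyl_singleton.1 h₂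
  obtain ⟨R, hR, hR'⟩ := Ray.exists_append γ.dropLast r'
    (by rwa [hr0', List.dropLast_append_getLast hne])
  have hRe : R.toEnd = r'.toEnd :=
    Ray.toEnd_eq_iff.2 ⟨γ.dropLast.length, 0, fun k => by rw [hR', Nat.zero_add]⟩
  have hR0 : R.1 0 = γ.head hne := by
    rcases List.eq_nil_or_concat γ with h | ⟨l, a, h⟩
    · exact absurd h hne
    · subst h
      simp only [List.concat_eq_append] at *
      cases l with
      | nil => simpa using (hR' 0).trans hr0'
      | cons b l => simpa using hR 0 (by simp)
  obtain ⟨hr1, hr2⟩ := r.2 0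
  rw [hr0, t_bar, ← hR0] at hr1
  rw [hr0, G.bar_bar, ← hR0] at hr2
  refine hG.toEnd_ne (r := r.drop 1) (r' := R) hr1.symm hr2 ?_
  rw [Ray.toEnd_drop, hr, hRe, hr']

section

variable (hG : G.IsTree) {ℓ : E → ℝ} (h0 : ∀ e, 0 ≤ ℓ e) (hbar : ∀ e, ℓ (G.bar e) = ℓ e)

include hG h0 hbar

theorem IsBiinfinite.dist_add_dist {c : ℤ → E} (hc : G.IsBiinfinite c) {a i j : ℤ} (hai : a < i)
    (hij : i < j) (s s' s'' : unitInterval) :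
    G.dist ℓ (G.onEdge (c a) s) (G.onEdge (c i) s') +
      G.dist ℓ (G.onEdge (c i) s') (G.onEdge (c j) s'') =
    G.dist ℓ (G.onEdge (c a) s) (G.onEdge (c j) s'') := by
  obtain ⟨m, rfl⟩ : ∃ m : ℕ, i = a + m := ⟨(i - a).toNat, by omega⟩
  obtain ⟨n, rfl⟩ : ∃ n : ℕ, j = a + n := ⟨(j - a).toNat, by omega⟩
  have h₁ := (hc.forward a).dist_eq_pos_sub hG h0 hbar (i := 0) (j := m) (by omega) s s'
  have h₂ := (hc.forward a).dist_eq_pos_sub hG h0 hbar (i := m) (j := n) (by omega) s' s''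
  have h₃ := (hc.forward a).dist_eq_pos_sub hG h0 hbar (i := 0) (j := n) (by omega) s s''
  simp only [forward, Nat.cast_zero, add_zero] at h₁ h₂ h₃
  rw [h₁, h₂, h₃]
  ring

/-- Points of the geodesic `[ξ, ζ]` lie between all points far out towards `ξ` and `ζ`, so the
Busemann functions of the two ends add up to zero on it. -/
theorem busemann_add_busemann_of_mem_line {ξ ζ : G.Boundary} {p p' : G.Point}
    (hp : p ∈ G.line ξ ζ) (hp' : p' ∈ G.line ξ ζ) :
    G.busemann ℓ ξ p p' + G.busemann ℓ ζ p p' = 0 := by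
  obtain ⟨c, i, s, hl, rfl⟩ := hp
  obtain ⟨c', i', s', hl', rfl⟩ := hp'
  obtain ⟨hc, h₁, h₂⟩ := isLine_iff.1 hl
  obtain ⟨hc', h₁', h₂'⟩ := isLine_iff.1 hl'
  obtain ⟨m, n, hmn⟩ := Ray.toEnd_eq_iff.1 (h₁'.trans h₁.symm)
  obtain ⟨m', n', hmn'⟩ := Ray.toEnd_eq_iff.1 (h₂'.trans h₂.symm)
  have hξ := (hc.reverse.forward 0).eventually_onEdge_mem
    (eventually_busemann hG h0 hbar _ (G.onEdge (c i) s) (G.onEdge (c' i') s'))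
  have hζ := (hc.forward 0).eventually_onEdge_mem
    (eventually_busemann hG h0 hbar _ (G.onEdge (c i) s) (G.onEdge (c' i') s'))
  rw [h₁] at hξ
  rw [h₂] at hζ
  obtain ⟨K, hK⟩ := eventually_atTop.1 (hξ.and hζ)
  obtain ⟨k, hkK, hki, hki'⟩ : ∃ k, K ≤ k ∧ i.natAbs < k ∧ i'.natAbs < k :=
    ⟨K + i.natAbs + i'.natAbs + 1, by omega, by omega, by omega⟩
  have e₁ := (hK (n + k) (by omega)).1 0
  have e₂ := (hK (n' + k) (by omega)).2 0
  have e₃ := hmn k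
  have e₄ := hmn' k
  have h01 (e : E) : G.onEdge (G.bar e) 0 = G.onEdge e 1 := by
    rw [onEdge_bar e 1, unitInterval.symm_one]
  simp only [IsBiinfinite.forward, zero_add, mem_ofPred_eq, h01] at e₁ e₂ e₃ e₄
  rw [bar_inj] at e₃
  have d₁ := hc.dist_add_dist hG h0 hbar (a := -1 - ((n + k : ℕ) : ℤ)) (i := i)
    (j := (n' + k : ℕ)) (by omega) (by omega) 1 s 0
  have d₂ := hc'.dist_add_dist hG h0 hbar (a := -1 - ((m + k : ℕ) : ℤ)) (i := i')
    (j := (m' + k : ℕ)) (by omega) (by omega) 1 s' 0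
  rw [e₃, e₄] at d₂
  rw [dist_symm hbar (G.onEdge (c i) s), dist_symm hbar (G.onEdge (c' i') s')] at e₁
  linarith

theorem busemann_self (ξ : G.Boundary) (x : G.Point) : G.busemann ℓ ξ x x = 0 := by
  have := busemann_add hG h0 hbar ξ x x x
  linarith

theorem Ray.busemann_eq_dist (r : G.Ray) {i n : ℕ} (h : i < n) (s : unitInterval) :
    G.busemann ℓ r.toEnd (G.onEdge (r.1 i) s) (G.onEdge (r.1 n) 0) =
      G.dist ℓ (G.onEdge (r.1 i) s) (G.onEdge (r.1 n) 0) := by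
  rw [r.dist_eq_pos_sub hG h0 hbar h]
  refine (busemann_eq_of_eventually (eventually_dist_sub_of_ray hG h0 hbar
    (h.trans n.lt_succ_self) n.lt_succ_self rfl s 0 (r.toEnd_mem_cyl _))).trans ?_
  ring

/-- If the rays from a point to two ends share their first edge, then they run together up to the
projection of the point to the geodesic between the ends. -/
theorem exists_projection_of_rays {r r' : G.Ray} (hne : r.toEnd ≠ r'.toEnd) (h : r.1 0 = r'.1 0)
    (s : unitInterval) : ∃ p ∈ G.line r.toEnd r'.toEnd,
      G.busemann ℓ r.toEnd (G.onEdge (r.1 0) s) p = G.dist ℓ (G.onEdge (r.1 0) s) p ∧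
      G.busemann ℓ r'.toEnd (G.onEdge (r.1 0) s) p = G.dist ℓ (G.onEdge (r.1 0) s) p := by
  classical
  have hex : ∃ n, r.1 n ≠ r'.1 n := by
    by_contra! hcon
    exact hne (congrArg Ray.toEnd (Subtype.ext (funext hcon)))
  obtain ⟨n, hn⟩ : ∃ n, Nat.find hex = n + 1 := by
    refine Nat.exists_eq_succ_of_ne_zero fun h' => ?_
    have := Nat.find_spec hex
    rw [h'] at this
    exact this h
  have hn₁ : r.1 (n + 1) ≠ r'.1 (n + 1) := hn ▸ Nat.find_spec hex
  have hn₂ : r.1 n = r'.1 n := by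
    have := Nat.find_min hex (m := n) (by omega)
    exact not_not.1 this
  have ho : G.o (r.1 (n + 1)) = G.o (r'.1 (n + 1)) := by
    rw [← (r.2 n).1, ← (r'.2 n).1, hn₂]
  obtain ⟨c, hc, hcr⟩ := exists_isLine_of_rays (r := r.drop (n + 1)) (r' := r'.drop (n + 1)) ho hn₁
  rw [Ray.toEnd_drop, Ray.toEnd_drop] at hc
  have hp : G.onEdge (r.1 (n + 1)) 0 = G.onEdge (r'.1 (n + 1)) 0 := by
    rw [← vertex_o, ← vertex_o, ho]
  refine ⟨G.onEdge (r.1 (n + 1)) 0, ⟨c, 0, 0, hc, ?_⟩,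
    r.busemann_eq_dist hG h0 hbar n.succ_pos s, ?_⟩
  · rw [hp]
    congr 1
    exact (hcr 0).2
  · rw [hp, h]
    exact r'.busemann_eq_dist hG h0 hbar n.succ_pos s

/-- The projection of a point to the geodesic between two ends: the rays from the point to both
ends pass through it. -/
theorem exists_projection (z : G.Point) {ξ ζ : G.Boundary} (hne : ξ ≠ ζ) :
    ∃ p ∈ G.line ξ ζ, G.busemann ℓ ξ z p = G.dist ℓ z p ∧ G.busemann ℓ ζ z p = G.dist ℓ z p := by
  obtain ⟨r₀, s, -, rfl⟩ := hG.exists_ray_onEdge z ξ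
  generalize r₀.1 0 = e
  obtain ⟨r, rfl, hr⟩ := hG.exists_ray (G.o e) ξ
  obtain ⟨r', rfl, hr'⟩ := hG.exists_ray (G.o e) ζ
  have hmem (h : G.onEdge e s ∈ G.line r.toEnd r'.toEnd) : ∃ p ∈ G.line r.toEnd r'.toEnd,
      G.busemann ℓ r.toEnd (G.onEdge e s) p = G.dist ℓ (G.onEdge e s) p ∧
      G.busemann ℓ r'.toEnd (G.onEdge e s) p = G.dist ℓ (G.onEdge e s) p :=
    ⟨_, h, by rw [busemann_self hG h0 hbar, dist_onEdge_self hG h0 hbar],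
      by rw [busemann_self hG h0 hbar, dist_onEdge_self hG h0 hbar]⟩
  -- If only one of the two rays from `o e` starts with `e`, then the line contains `e`; if none
  -- does, both can be prolonged by `bar e`.
  by_cases h : r.1 0 = e <;> by_cases h' : r'.1 0 = e
  · obtain ⟨p, hp⟩ := exists_projection_of_rays hG h0 hbar hne (h.trans h'.symm) s
    rw [h] at hp
    exact ⟨p, hp⟩
  · obtain ⟨c, hc, hcr⟩ := exists_isLine_of_rays (hr.trans hr'.symm) (fun h₁ => h' (h₁ ▸ h))
    refine hmem ⟨c, -1, unitInterval.symm s, hc, ?_⟩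
    have := (hcr 0).1
    rw [onEdge_bar, ← h, this, G.bar_bar]
    simp
  · obtain ⟨c, hc, hcr⟩ := exists_isLine_of_rays (hr.trans hr'.symm) (fun h₁ => h (h₁ ▸ h'))
    refine hmem ⟨c, 0, s, hc, ?_⟩
    rw [← h', (hcr 0).2, Nat.cast_zero]
  · have hb : G.t (G.bar e) = G.o (r.1 0) ∧ r.1 0 ≠ G.bar (G.bar e) :=
      ⟨by rw [t_bar, hr], by rwa [G.bar_bar]⟩
    have hb' : G.t (G.bar e) = G.o (r'.1 0) ∧ r'.1 0 ≠ G.bar (G.bar e) :=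
      ⟨by rw [t_bar, hr'], by rwa [G.bar_bar]⟩
    rw [onEdge_bar]
    rw [← Ray.toEnd_cons hb, ← Ray.toEnd_cons hb'] at hne ⊢
    exact exists_projection_of_rays hG h0 hbar hne rfl (unitInterval.symm s)

/-- The distance to a geodesic line, expressed by Busemann functions. -/
theorem two_mul_distLine (z : G.Point) (q : G.Boundary₂) {p : G.Point}
    (hp : p ∈ G.line q.1.1 q.1.2) :
    2 * G.distLine ℓ z q = G.busemann ℓ q.1.1 z p + G.busemann ℓ q.1.2 z p := by
  obtain ⟨p₀, hp₀, h₁, h₂⟩ := exists_projection hG h0 hbar z q.2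
  have key {p' : G.Point} (hp' : p' ∈ G.line q.1.1 q.1.2) :
      G.busemann ℓ q.1.1 z p' + G.busemann ℓ q.1.2 z p' = 2 * G.dist ℓ z p₀ := by
    have := busemann_add_busemann_of_mem_line hG h0 hbar hp₀ hp'
    rw [← busemann_add hG h0 hbar q.1.1 z p₀ p', ← busemann_add hG h0 hbar q.1.2 z p₀ p', h₁, h₂]
    linarith
  have hleast : IsLeast (G.dist ℓ z '' G.line q.1.1 q.1.2) (G.dist ℓ z p₀) := by
    refine ⟨⟨p₀, hp₀, rfl⟩, ?_⟩
    rintro _ ⟨p', hp', rfl⟩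
    have h₃ := (le_abs_self _).trans (abs_busemann_le hG h0 hbar q.1.1 z p')
    have h₄ := (le_abs_self _).trans (abs_busemann_le hG h0 hbar q.1.2 z p')
    have h₅ := key hp'
    linarith
  rw [key hp, distLine, hleast.csInf_eq]

theorem exists_mem_line (q : G.Boundary₂) : ∃ p, p ∈ G.line q.1.1 q.1.2 := by
  obtain ⟨v⟩ := hG.1
  obtain ⟨p, hp, -⟩ := exists_projection hG h0 hbar (G.vertex v) q.2
  exact ⟨p, hp⟩

theorem distLine_eq_zero {z : G.Point} {q : G.Boundary₂} (hz : z ∈ G.line q.1.1 q.1.2) :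
    G.distLine ℓ z q = 0 := by
  have h := two_mul_distLine hG h0 hbar z q hz
  rw [busemann_self hG h0 hbar, busemann_self hG h0 hbar] at h
  linarith

theorem distLine_nonneg (z : G.Point) (q : G.Boundary₂) : 0 ≤ G.distLine ℓ z q :=
  Real.sInf_nonneg (by rintro _ ⟨p, -, rfl⟩; exact dist_nonneg hG h0 hbar z p)

/-- The change of base point in the distance to a line. -/
theorem two_mul_distLine_eq_add (z y : G.Point) (q : G.Boundary₂) :
    2 * G.distLine ℓ z q = G.busemann ℓ q.1.1 z y + G.busemann ℓ q.1.2 z y +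
      2 * G.distLine ℓ y q := by
  obtain ⟨p, hp⟩ := exists_mem_line hG h0 hbar q
  rw [two_mul_distLine hG h0 hbar z q hp, two_mul_distLine hG h0 hbar y q hp,
    ← busemann_add hG h0 hbar q.1.1 z y p, ← busemann_add hG h0 hbar q.1.2 z y p]
  ring

theorem abs_distLine_sub_le (z y : G.Point) (q : G.Boundary₂) :
    |G.distLine ℓ z q - G.distLine ℓ y q| ≤ G.dist ℓ z y := by
  have h := two_mul_distLine_eq_add hG h0 hbar z y q
  have h₁ := abs_le.1 (abs_busemann_le hG h0 hbar q.1.1 z y)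
  have h₂ := abs_le.1 (abs_busemann_le hG h0 hbar q.1.2 z y)
  rw [abs_le]
  constructor <;> linarith

/-- The Busemann function between the ends of a reduced path, at the ends in front of it. -/
theorem busemann_of_isReduced {γ : List E} (hne : γ ≠ []) {f : E} (hγ : G.IsReduced (γ ++ [f]))
    {ξ : G.Boundary} (hξ : ξ ∈ G.cyl [f]) :
    G.busemann ℓ ξ (G.vertex (G.o (γ.head hne))) (G.vertex (G.o f)) = (γ.map ℓ).sum := by
  obtain ⟨r, rfl, rfl⟩ := mem_cyl_singleton.1 hξ
  obtain ⟨R, hR, hR'⟩ := Ray.exists_append γ r hγ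
  have hlen := List.length_pos_of_ne_nil hne
  have h := busemann_eq_of_eventually (eventually_dist_sub_of_ray hG h0 hbar (r := R) (r' := r)
    (i := 0) (j := 0) (n := γ.length + 1) (m := 1) (Nat.succ_pos _) one_pos (hR' 1) 0 0
    (ξ := r.toEnd) (by rw [hR']; exact r.toEnd_mem_cyl 1))
  have hγR : γ = (List.range' 0 γ.length).map R.1 :=
    List.ext_getElem (by simp) fun i hi _ => by simp [hR i hi]
  rw [vertex_o, vertex_o, List.head_eq_getElem, ← hR 0 hlen, h]
  conv_rhs => rw [hγR, List.map_map, sum_map_range']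
  have h₀ := hR' 0
  rw [Nat.add_zero] at h₀
  simp [Ray.pos, Finset.sum_range_succ, h₀]

end

theorem distLine_flip (ℓ : E → ℝ) (z : G.Point) (q : G.Boundary₂) :
    G.distLine ℓ z (G.flip q) = G.distLine ℓ z q := by
  unfold distLine
  rw [line_symm]
  rfl

end Lines

/-! ### The action on the universal cover -/

section Cover

variable {V E V' E' : Type*} {X : SerreGraph V E} {Γ : SerreGraph V' E'} (j : Covering X Γ)

theorem Covering.onE_inj {e f : E} (ho : X.o e = X.o f) (h : j.onE e = j.onE f) : e = f :=
  (j.lift (X.o f) (j.onE f) (j.onE_o f)).unique ⟨ho, h⟩ ⟨rfl, rfl⟩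

theorem Covering.onV_t (e : E) : j.onV (X.t e) = Γ.t (j.onE e) := by
  rw [t, ← j.onE_o, j.onE_bar, t]

theorem Covering.isPath_map {u v : V} {l : List E} (h : X.IsPath u l v) :
    Γ.IsPath (j.onV u) (l.map j.onE) (j.onV v) := by
  induction l generalizing u with
  | nil => exact congrArg j.onV h
  | cons e l ih =>
    obtain ⟨rfl, h⟩ := h
    exact ⟨j.onE_o e, by rw [← j.onV_t]; exact ih h⟩

/-- Lifts of paths with a given origin are unique. -/
theorem Covering.path_unique {u v v' : V} {l l' : List E} (h : X.IsPath u l v)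
    (h' : X.IsPath u l' v') (hl : l.map j.onE = l'.map j.onE) : l = l' ∧ v = v' := by
  induction l generalizing u l' with
  | nil =>
    obtain rfl : l' = [] := List.map_eq_nil_iff.1 hl.symm
    exact ⟨rfl, h.symm.trans h'⟩
  | cons e l ih =>
    cases l' with
    | nil => simp at hl
    | cons e' l' =>
      simp only [List.map_cons, List.cons.injEq] at hl
      obtain rfl := j.onE_inj (h.1.trans h'.1.symm) hl.1
      obtain ⟨rfl, rfl⟩ := ih h.2 h'.2 hl.2
      exact ⟨rfl, rfl⟩

include j in
/-- A path of the covering is determined by its origin and its image, so a tree that covers a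
finite graph has countably many edges. -/
theorem Covering.countable (hX : X.IsTree) [Countable E'] : Countable E := by
  obtain ⟨x⟩ := hX.1
  choose l hl _ using fun e => hX.2 x (X.o e)
  have hp (e : E) : X.IsPath x (l e ++ [e]) (X.t e) := (hl e).1.append X ⟨rfl, rfl⟩
  refine Function.Injective.countable (f := fun e => (l e ++ [e]).map j.onE) fun e e' h => ?_
  have := congrArg List.getLast? (j.path_unique (hp e) (hp e') h).1
  simpa using this

theorem rev_rev (l : List E) : X.rev (X.rev l) = l := by
  simp only [rev, List.map_reverse, List.reverse_reverse, List.map_map]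
  convert List.map_id l
  exact funext X.bar_bar

theorem Covering.map_rev (l : List E) : (X.rev l).map j.onE = Γ.rev (l.map j.onE) := by
  simp only [rev, List.map_reverse, List.map_map]
  congr 2
  exact funext j.onE_bar

theorem exists_backtracking_of_not_isReduced {u v : V} {l : List E} (h : X.IsPath u l v)
    (hl : ¬ X.IsReduced l) : ∃ a c e, l = a ++ e :: X.bar e :: c := by
  induction l generalizing u with
  | nil => exact absurd List.isChain_nil hl
  | cons e l ih =>
    by_cases hl' : X.IsReduced l
    · cases l with
      | nil => exact absurd (List.isChain_singleton e) hl
      | cons f l =>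
        by_cases hf : f = X.bar e
        · exact ⟨[], l, e, by rw [hf]; rfl⟩
        · exact absurd (isReduced_cons_cons.2 ⟨⟨h.2.1.symm, hf⟩, hl'⟩) hl
    · obtain ⟨a, c, f, rfl⟩ := ih h.2 hl'
      exact ⟨e :: a, c, f, rfl⟩

/-- Closed paths in a tree are null-homotopic, hence so are their images under a covering. -/
theorem Covering.loopClass_map_eq_one (hX : X.IsTree) {x : V} (l : List E) (h : X.IsPath x l x)
    (h' : Γ.IsPath (j.onV x) (l.map j.onE) (j.onV x)) :
    Γ.loopClass ⟨l.map j.onE, h'⟩ = 1 := by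
  induction hn : l.length using Nat.strong_induction_on generalizing l with
  | _ n ih =>
    by_cases hl : X.IsReduced l
    · obtain rfl := hX.eq_of_isReduced h hl (m := []) rfl List.isChain_nil
      rfl
    · obtain ⟨a, c, e, rfl⟩ := exists_backtracking_of_not_isReduced h hl
      obtain ⟨v, ha, hv, -, hc⟩ := isPath_append.1 h
      rw [t_bar, hv] at hc
      have hac := ha.append X hc
      rw [← ih _ (by rw [← hn]; simp) (a ++ c) hac (j.isPath_map hac) rfl]
      refine Quot.sound ⟨a.map j.onE, c.map j.onE, j.onE e, ?_, ?_⟩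
      · simp [j.onE_bar]
      · simp

variable {F : Type*} [Group F] [MulAction F V] [MulAction F E] [Acts F X] {j}

theorem smul_vertex (g : F) (v : V) : g • X.vertex v = X.vertex (g • v) := rfl

theorem inv_smul_smul_point (g : F) (x : X.Point) : g⁻¹ • g • x = x := by
  rcases x with ⟨v | ⟨e, s⟩⟩
  · exact congrArg X.vertex (inv_smul_smul g v)
  · exact congrArg (X.onEdge · s) (inv_smul_smul g e)

theorem IsPath.smul (g : F) {u v : V} {l : List E} (h : X.IsPath u l v) :
    X.IsPath (g • u) (l.map (g • ·)) (g • v) := by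
  induction l generalizing u with
  | nil => exact congrArg (g • ·) h
  | cons e l ih =>
    obtain ⟨rfl, h⟩ := h
    exact ⟨Acts.smul_o g e, by rw [smul_t]; exact ih h⟩

variable {x₀ : V} {α : F ≃* Γ.FundamentalGroup (j.onV x₀)}

/-- The action by deck transformations is free on vertices: an element that fixes one vertex fixes
the base vertex, and is then the class of a loop with a closed lift. -/
theorem ActsThrough.eq_one_of_smul_vertex (hact : ActsThrough F j x₀ α) (hX : X.IsTree) {g : F}
    {v : V} (h : g • v = v) : g = 1 := by
  have hx : g • x₀ = x₀ := by
    obtain ⟨l, ⟨hl, -⟩, -⟩ := hX.2 v x₀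
    have h' := hl.smul g
    rw [h] at h'
    refine (j.path_unique hl h' ?_).2.symm
    rw [List.map_map]
    exact List.map_congr_left fun e _ => (hact.onE_smul g e).symm
  obtain ⟨m, hm⟩ := Quot.exists_rep (α g)
  obtain ⟨l, hl, hp⟩ := hact.smul_base g m hm.symm
  rw [hx] at hp
  have h₁ := j.loopClass_map_eq_one hX l hp (j.isPath_map hp)
  have h₂ : α g = 1 := by
    rw [← hm, ← h₁]
    exact congrArg Γ.loopClass (Subtype.ext hl.symm)
  exact (MulEquiv.map_eq_one_iff α).1 h₂

/-- Deck transformations act transitively on the fibres of the covering. -/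
theorem ActsThrough.exists_smul_eq (hact : ActsThrough F j x₀ α) (hX : X.IsTree) {e f : E}
    (h : j.onE e = j.onE f) : ∃ g : F, g • e = f := by
  obtain ⟨l, ⟨hl, -⟩, -⟩ := hX.2 x₀ (X.o e)
  obtain ⟨l', ⟨hl', -⟩, -⟩ := hX.2 x₀ (X.o f)
  have hv : j.onV (X.o e) = j.onV (X.o f) := by rw [← j.onE_o, ← j.onE_o, h]
  have hm : Γ.IsPath (j.onV x₀) (l'.map j.onE ++ Γ.rev (l.map j.onE)) (j.onV x₀) := by
    refine (j.isPath_map hl').append Γ ?_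
    rw [← hv]
    exact (j.isPath_map hl).rev
  obtain ⟨g, hg⟩ := α.surjective (Γ.loopClass ⟨_, hm⟩)
  obtain ⟨l'', hl'', hp⟩ := hact.smul_base g _ hg
  obtain ⟨a, c, rfl, ha, hc⟩ := List.map_eq_append_iff.1 hl''
  obtain ⟨v, hpa, hpc⟩ := isPath_append.1 hp
  -- The lift of the loop starts with the path to the origin of `f`, and the remaining part is the
  -- translate of the path to the origin of `e`, run backwards.
  obtain ⟨-, rfl⟩ := j.path_unique hpa hl' ha
  have h₁ := hpc.rev
  have h₂ := (j.path_unique h₁ (hl.smul g) (by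
    rw [j.map_rev, hc, rev_rev, List.map_map]
    exact List.map_congr_left fun e _ => (hact.onE_smul g e).symm)).2
  refine ⟨g, j.onE_inj ?_ ((hact.onE_smul g e).trans h)⟩
  rw [Acts.smul_o, h₂]

/-- The stabilizer of an end of the tree is abelian: two elements that fix the end translate a ray
towards it, so their commutator fixes some edge. -/
theorem ActsThrough.commute_of_smul_end (hact : ActsThrough F j x₀ α) (hX : X.IsTree)
    {ξ : X.Boundary} {g g' : F} (h : g • ξ = ξ) (h' : g' • ξ = ξ) : g * g' = g' * g := by
  obtain ⟨r, rfl⟩ := exists_toEnd ξ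
  obtain ⟨m, n, hmn⟩ := Ray.toEnd_eq_iff.1 (show (Ray.translate g r).toEnd = r.toEnd from h)
  obtain ⟨m', n', hmn'⟩ := Ray.toEnd_eq_iff.1 (show (Ray.translate g' r).toEnd = r.toEnd from h')
  have e₁ (k : ℕ) : g • r.1 (m + k) = r.1 (n + k) := hmn k
  have e₂ (k : ℕ) : g' • r.1 (m' + k) = r.1 (n' + k) := hmn' k
  have h₁ : (g * g') • r.1 (m' + (m + n' + m' + n)) =
      (g' * g) • r.1 (m' + (m + n' + m' + n)) := by
    rw [mul_smul, mul_smul, e₂, show n' + (m + n' + m' + n) = m + (n' + n' + m' + n) by omega, e₁,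
      show m' + (m + n' + m' + n) = m + (m' + n' + m' + n) by omega, e₁,
      show n + (m' + n' + m' + n) = m' + (n + n' + m' + n) by omega, e₂]
    exact congrArg r.1 (by omega)
  have h₂ := congrArg X.o h₁
  rw [Acts.smul_o, Acts.smul_o] at h₂
  have h₃ : (g' * g)⁻¹ * (g * g') = 1 := hact.eq_one_of_smul_vertex hX
    (v := X.o (r.1 (m' + (m + n' + m' + n)))) (by rw [mul_smul, h₂, inv_smul_smul])
  exact (inv_mul_eq_one.1 h₃).symm

theorem exists_not_commute {k : ℕ} (hk : 2 ≤ k) (hF : Nonempty (F ≃* FreeGroup (Fin k))) :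
    ∃ g g' : F, g * g' ≠ g' * g := by
  obtain ⟨φ⟩ := hF
  -- Two transpositions of three points do not commute.
  let ψ : FreeGroup (Fin k) →* Equiv.Perm (Fin 3) :=
    FreeGroup.lift fun i => if i.1 = 0 then Equiv.swap 0 1 else Equiv.swap 1 2
  refine ⟨φ.symm (FreeGroup.of ⟨0, by omega⟩), φ.symm (FreeGroup.of ⟨1, by omega⟩), fun h => ?_⟩
  have h' := congrArg (fun g => ψ (φ g)) h
  simp only [map_mul, MulEquiv.apply_symm_apply, ψ, FreeGroup.lift_apply_of, one_ne_zero,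
    ↓reduceIte] at h'
  exact absurd h' (by decide)

section Invariance

variable {ℓ : E → ℝ} (hℓ : ∀ (g : F) e, ℓ (g • e) = ℓ e)

include hℓ

theorem Tether.smul (g : F) {x : X.Point} {u : V} {a : ℝ} (h : X.Tether ℓ x u a) :
    X.Tether ℓ (g • x) (g • u) a := by
  rcases h with ⟨rfl, rfl⟩ | ⟨e, s, rfl, rfl, rfl⟩
  · exact Or.inl ⟨rfl, rfl⟩
  · exact Or.inr ⟨g • e, s, rfl, Acts.smul_o g e, by rw [hℓ]⟩

theorem dist_smul (g : F) (x y : X.Point) : X.dist ℓ (g • x) (g • y) = X.dist ℓ x y := by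
  have key (g : F) (x y : X.Point) (r : ℝ) :
      ((∃ (u v : V) (a c : ℝ) (l : List E), X.Tether ℓ x u a ∧ X.Tether ℓ y v c ∧
        X.IsPath u l v ∧ r = a + (l.map ℓ).sum + c) ∨
      ∃ (e : E) (s s' : unitInterval), x = X.onEdge e s ∧ y = X.onEdge e s' ∧
        r = |(s : ℝ) - s'| * ℓ e) →
      ((∃ (u v : V) (a c : ℝ) (l : List E), X.Tether ℓ (g • x) u a ∧ X.Tether ℓ (g • y) v c ∧
        X.IsPath u l v ∧ r = a + (l.map ℓ).sum + c) ∨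
      ∃ (e : E) (s s' : unitInterval), g • x = X.onEdge e s ∧ g • y = X.onEdge e s' ∧
        r = |(s : ℝ) - s'| * ℓ e) := by
    rintro (⟨u, v, a, c, l, hu, hv, hl, rfl⟩ | ⟨e, s, s', rfl, rfl, rfl⟩)
    · refine Or.inl ⟨g • u, g • v, a, c, _, Tether.smul hℓ g hu, Tether.smul hℓ g hv, hl.smul g, ?_⟩
      rw [List.map_map]
      congr 3
      exact List.map_congr_left fun e _ => (hℓ g e).symm
    · exact Or.inr ⟨g • e, s, s', rfl, rfl, by rw [hℓ]⟩
  unfold dist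
  congr 1
  ext r
  refine ⟨fun h => ?_, key g x y r⟩
  have := key g⁻¹ _ _ r h
  rwa [inv_smul_smul_point, inv_smul_smul_point] at this

omit hℓ in
theorem IsLine.smul (g : F) {c : ℤ → E} {ξ ζ : X.Boundary} (h : X.IsLine c ξ ζ) :
    X.IsLine (fun n => g • c n) (g • ξ) (g • ζ) := by
  obtain ⟨hc, r, r', rfl, rfl, h⟩ := h
  refine ⟨fun n => ?_, r.translate g, r'.translate g, rfl, rfl, fun n => ?_⟩
  · rw [smul_t, Acts.smul_o, Acts.smul_bar, (hc n).1]
    exact ⟨rfl, fun h => (hc n).2 (MulAction.injective g h)⟩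
  · refine ⟨?_, congrArg (g • ·) (h n).2⟩
    rw [Acts.smul_bar]
    exact congrArg (g • ·) (h n).1

theorem distLine_smul (g : F) (z : X.Point) (q : X.Boundary₂) :
    X.distLine ℓ (g • z) (g • q) = X.distLine ℓ z q := by
  have hline (g : F) (ξ ζ : X.Boundary) {p : X.Point} (hp : p ∈ X.line ξ ζ) :
      g • p ∈ X.line (g • ξ) (g • ζ) := by
    obtain ⟨c, n, s, hc, rfl⟩ := hp
    exact ⟨_, n, s, hc.smul g, rfl⟩
  unfold distLine
  congr 1
  ext a
  constructor
  · rintro ⟨p, hp, rfl⟩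
    have := hline g⁻¹ _ _ hp
    rw [show (g • q).1.1 = g • q.1.1 from rfl, show (g • q).1.2 = g • q.1.2 from rfl,
      inv_smul_smul, inv_smul_smul] at this
    refine ⟨_, this, ?_⟩
    rw [← dist_smul hℓ g⁻¹ (g • z) p, inv_smul_smul_point]
  · rintro ⟨p, hp, rfl⟩
    exact ⟨g • p, hline g _ _ hp, dist_smul hℓ g z p⟩

end Invariance

end Cover

/-! ### Measurability -/

section Measurability

variable {V E : Type*} {G : SerreGraph V E}

theorem isOpen_cyl (γ : List E) : IsOpen (G.cyl γ) :=
  TopologicalSpace.isOpen_generateFrom_of_mem ⟨γ, rfl⟩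

theorem measurableSet_cyl (γ : List E) : MeasurableSet (G.cyl γ) := (isOpen_cyl γ).measurableSet

theorem mem_cyl₂_singleton {e : E} {q : G.Boundary₂} :
    q ∈ G.cyl₂ [e] ↔ q.1.1 ∈ G.cyl [G.bar e] ∧ q.1.2 ∈ G.cyl [e] :=
  mem_cyl₂_iff (List.cons_ne_nil e []) (List.isChain_singleton e) q

theorem vertex_mem_line {γ : List E} (hne : γ ≠ []) {q : G.Boundary₂} (hq : q ∈ G.cyl₂ γ) :
    G.vertex (G.o (γ.head hne)) ∈ G.line q.1.1 q.1.2 := by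
  obtain ⟨c, n, hc, h⟩ := hq
  refine ⟨c, n, 0, hc, ?_⟩
  have := h 0 (List.length_pos_of_ne_nil hne)
  rw [vertex_o, List.head_eq_getElem, ← this, Nat.cast_zero, add_zero]

theorem isOpen_cyl₂ {γ : List E} (hne : γ ≠ []) (hγ : G.IsReduced γ) : IsOpen (G.cyl₂ γ) := by
  have h : G.cyl₂ γ = Subtype.val ⁻¹' (G.cyl [G.bar (γ.head hne)] ×ˢ G.cyl [γ.getLast hne]) :=
    Set.ext fun q => mem_cyl₂_iff hne hγ q
  rw [h]
  exact ((isOpen_cyl _).prod (isOpen_cyl _)).preimage continuous_subtype_val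

theorem measurableSet_cyl₂ {γ : List E} (hne : γ ≠ []) (hγ : G.IsReduced γ) :
    MeasurableSet (G.cyl₂ γ) := by
  have h : G.cyl₂ γ = Subtype.val ⁻¹' (G.cyl [G.bar (γ.head hne)] ×ˢ G.cyl [γ.getLast hne]) :=
    Set.ext fun q => mem_cyl₂_iff hne hγ q
  rw [h]
  exact measurable_subtype_coe ((measurableSet_cyl _).prod (measurableSet_cyl _))

variable (hG : G.IsTree)

include hG

theorem IsTree.exists_mem_cyl₂ (q : G.Boundary₂) : ∃ e : E, q ∈ G.cyl₂ [e] := by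
  obtain ⟨_, c, n, s, hc, rfl⟩ := exists_mem_line hG (ℓ := 0) (fun _ => le_rfl) (fun _ => rfl) q
  refine ⟨c n, c, n, hc, fun i hi => ?_⟩
  obtain rfl : i = 0 := by simpa using hi
  simp

theorem IsTree.image_cyl₂ {γ : List E} (hne : γ ≠ []) (hγ : G.IsReduced γ) :
    Subtype.val '' G.cyl₂ γ = G.cyl [G.bar (γ.head hne)] ×ˢ G.cyl [γ.getLast hne] := by
  ext ⟨ξ, ζ⟩
  constructor
  · rintro ⟨q, hq, h⟩
    rw [← h]
    exact (mem_cyl₂_iff hne hγ q).1 hq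
  · intro h
    have hξζ : ξ ≠ ζ := by
      rintro rfl
      exact Set.disjoint_left.1 (hG.disjoint_cyl_of_isReduced hne hγ) h.1 h.2
    exact ⟨⟨(ξ, ζ), hξζ⟩, (mem_cyl₂_iff hne hγ _).2 h, rfl⟩

variable [Countable E]

/-- The complement of the diagonal is a countable union of products of cylinders. Without this,
`Measure.comap` along the inclusion would be a junk value. -/
theorem IsTree.measurableSet_offDiag :
    MeasurableSet {q : G.Boundary × G.Boundary | q.1 ≠ q.2} := by
  have h : {q : G.Boundary × G.Boundary | q.1 ≠ q.2} =
      ⋃ e, G.cyl [G.bar e] ×ˢ G.cyl [e] := by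
    ext q
    rw [Set.mem_iUnion]
    constructor
    · intro hq
      obtain ⟨e, he⟩ := hG.exists_mem_cyl₂ ⟨q, hq⟩
      exact ⟨e, mem_cyl₂_singleton.1 he⟩
    · rintro ⟨e, he⟩
      have := hG.image_cyl₂ (List.cons_ne_nil e []) (List.isChain_singleton e)
      obtain ⟨q', -, rfl⟩ := this.symm.subset he
      exact q'.2
  rw [h]
  exact MeasurableSet.iUnion fun e => (measurableSet_cyl _).prod (measurableSet_cyl _)

theorem IsTree.measurableEmbedding_val :
    MeasurableEmbedding (Subtype.val : G.Boundary₂ → G.Boundary × G.Boundary) :=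
  MeasurableEmbedding.subtype_coe hG.measurableSet_offDiag

variable {ℓ : E → ℝ} (h0 : ∀ e, 0 ≤ ℓ e) (hbar : ∀ e, ℓ (G.bar e) = ℓ e)

include h0 hbar

/-- Busemann functions are locally constant in the end, hence measurable. -/
theorem measurable_busemann (x y : G.Point) : Measurable fun ξ => G.busemann ℓ ξ x y := by
  intro S _
  have h : (fun ξ => G.busemann ℓ ξ x y) ⁻¹' S =
      ⋃ e ∈ {e : E | G.cyl [e] ⊆ (fun ξ => G.busemann ℓ ξ x y) ⁻¹' S}, G.cyl [e] := by
    refine Set.Subset.antisymm (fun ξ hξ => ?_) (Set.iUnion₂_subset fun e he => he)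
    obtain ⟨e, he, hc⟩ := exists_cyl_busemann_eq hG h0 hbar ξ x y
    refine Set.mem_iUnion₂.2 ⟨e, fun ξ' hξ' => ?_, he⟩
    show G.busemann ℓ ξ' x y ∈ S
    rw [hc ξ' hξ']
    exact hξ
  rw [h]
  exact MeasurableSet.biUnion (Set.to_countable _) fun e _ => measurableSet_cyl _

theorem measurable_distLine (z : G.Point) : Measurable (G.distLine ℓ z) := by
  intro S hS
  let f : E → G.Boundary₂ → ℝ := fun e q =>
    (G.busemann ℓ q.1.1 z (G.vertex (G.o e)) + G.busemann ℓ q.1.2 z (G.vertex (G.o e))) / 2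
  have hf (e : E) : Measurable (f e) := by
    have h := measurable_busemann hG h0 hbar z (G.vertex (G.o e))
    exact ((h.comp (measurable_fst.comp measurable_subtype_coe)).add
      (h.comp (measurable_snd.comp measurable_subtype_coe))).div_const 2
  have hfe {e : E} {q : G.Boundary₂} (hq : q ∈ G.cyl₂ [e]) : f e q = G.distLine ℓ z q := by
    have := two_mul_distLine hG h0 hbar z q (vertex_mem_line (List.cons_ne_nil e []) hq)
    simp only [List.head_cons] at this
    simp only [f, ← this]
    ring
  have h : G.distLine ℓ z ⁻¹' S = ⋃ e, G.cyl₂ [e] ∩ f e ⁻¹' S := by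
    ext q
    rw [Set.mem_iUnion]
    constructor
    · intro hq
      obtain ⟨e, he⟩ := hG.exists_mem_cyl₂ q
      exact ⟨e, he, show f e q ∈ S by rw [hfe he]; exact hq⟩
    · rintro ⟨e, he, hq⟩
      show G.distLine ℓ z q ∈ S
      rw [← hfe he]
      exact hq
  rw [h]
  exact MeasurableSet.iUnion fun e =>
    (measurableSet_cyl₂ (List.cons_ne_nil e []) (List.isChain_singleton e)).inter (hf e hS)

end Measurability

/-! ### The product measure off the diagonal -/

section OffDiag

variable {V E : Type*} {X : SerreGraph V E} (hX : X.IsTree) [Countable E]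

theorem map_withDensity_of_comp {α β : Type*} [MeasurableSpace α] [MeasurableSpace β]
    (m : Measure α) {φ : α → β} (hφ : Measurable φ) {ρ : α → ENNReal} {ρ' : β → ENNReal}
    (hρ' : Measurable ρ') (h : ∀ a, ρ' (φ a) = ρ a) :
    (m.withDensity ρ).map φ = (m.map φ).withDensity ρ' := by
  ext A hA
  rw [Measure.map_apply hφ hA, withDensity_apply _ (hφ hA), withDensity_apply _ hA,
    setLIntegral_map hA hρ' hφ]
  simp only [h]

omit [Countable E] in
theorem measurable_flip : Measurable X.flip :=
  ((measurable_snd.comp measurable_subtype_coe).prodMk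
    (measurable_fst.comp measurable_subtype_coe)).subtype_mk

include hX

theorem IsTree.offDiag_apply (m : FiniteMeasure X.Boundary) (A : Set X.Boundary₂) :
    X.offDiag m A = ((m : Measure X.Boundary).prod (m : Measure X.Boundary)) (Subtype.val '' A) :=
  hX.measurableEmbedding_val.comap_apply _ _

theorem IsTree.measurableSet_image {A : Set X.Boundary₂} (hA : MeasurableSet A) :
    MeasurableSet (Subtype.val '' A) :=
  hX.measurableEmbedding_val.measurableSet_image.2 hA

theorem IsTree.offDiag_withDensity {m m' : FiniteMeasure X.Boundary} {φ : X.Boundary → ENNReal}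
    (hφ : Measurable φ) (h : (m : Measure X.Boundary) = (m' : Measure X.Boundary).withDensity φ) :
    X.offDiag m = (X.offDiag m').withDensity fun q => φ q.1.1 * φ q.1.2 := by
  ext A hA
  rw [hX.offDiag_apply, h, prod_withDensity hφ hφ, withDensity_apply _ hA,
    withDensity_apply _ (hX.measurableSet_image hA)]
  exact (setLIntegral_subtype hX.measurableSet_offDiag A fun q => φ q.1 * φ q.2).symm

theorem IsTree.offDiag_map_flip (m : FiniteMeasure X.Boundary) :
    (X.offDiag m).map X.flip = X.offDiag m := by
  ext A hA
  rw [Measure.map_apply measurable_flip hA, hX.offDiag_apply, hX.offDiag_apply]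
  conv_rhs => rw [← Measure.prod_swap,
    Measure.map_apply measurable_swap (hX.measurableSet_image hA)]
  congr 1
  ext ⟨ξ, ζ⟩
  constructor
  · rintro ⟨q, hq, h⟩
    exact ⟨X.flip q, hq, by rw [← h]; rfl⟩
  · rintro ⟨q, hq, h⟩
    exact ⟨X.flip q, hq, congrArg Prod.swap h⟩

variable {F : Type*} [Group F] [MulAction F V] [MulAction F E] [Acts F X]

omit hX [Countable E] in
theorem measurable_smul_boundary (g : F) : Measurable fun ξ : X.Boundary => g • ξ := by
  refine Continuous.measurable (continuous_generateFrom_iff.2 ?_)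
  rintro _ ⟨γ, rfl⟩
  convert isOpen_cyl (G := X) (γ.map (g⁻¹ • ·)) using 1
  ext ξ
  constructor
  · rintro ⟨r, hr, h⟩
    refine ⟨r.translate g⁻¹, ?_, fun i hi => ?_⟩
    · rw [← inv_smul_smul g ξ, ← show r.toEnd = g • ξ from hr]
      rfl
    · rw [List.getElem_map, ← h i (by simpa using hi)]
      rfl
  · rintro ⟨r, rfl, h⟩
    refine ⟨r.translate g, rfl, fun i hi => ?_⟩
    have := h i (by simpa using hi)
    rw [List.getElem_map] at this
    rw [← smul_inv_smul g γ[i], ← this]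
    rfl

omit hX [Countable E] in
theorem measurable_smul_boundary₂ (g : F) : Measurable fun q : X.Boundary₂ => g • q :=
  (((measurable_smul_boundary g).comp (measurable_fst.comp measurable_subtype_coe)).prodMk
    ((measurable_smul_boundary g).comp (measurable_snd.comp measurable_subtype_coe))).subtype_mk

theorem IsTree.offDiag_map_smul (g : F) {m m' : FiniteMeasure X.Boundary}
    (h : (m' : Measure X.Boundary) = (m : Measure X.Boundary).map (g • ·)) :
    (X.offDiag m).map (g • ·) = X.offDiag m' := by
  have hg := measurable_smul_boundary (X := X) g
  ext A hA
  rw [Measure.map_apply (measurable_smul_boundary₂ g) hA, hX.offDiag_apply, hX.offDiag_apply, h,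
    Measure.map_prod_map _ _ hg hg,
    Measure.map_apply (hg.prodMap hg) (hX.measurableSet_image hA)]
  congr 1
  ext ⟨ξ, ζ⟩
  constructor
  · rintro ⟨q, hq, h⟩
    exact ⟨g • q, hq, by rw [← h]; rfl⟩
  · rintro ⟨q, hq, h⟩
    have hne : ξ ≠ ζ := by
      rintro rfl
      exact q.2 ((congrArg Prod.fst h).trans (congrArg Prod.snd h).symm)
    refine ⟨⟨(ξ, ζ), hne⟩, ?_, rfl⟩
    have : g • (⟨(ξ, ζ), hne⟩ : X.Boundary₂) = q := Subtype.ext h.symm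
    show g • (⟨(ξ, ζ), hne⟩ : X.Boundary₂) ∈ A
    rwa [this]

end OffDiag

/-! ### Patterson–Sullivan measures and currents -/

section Current

variable {V E V' E' : Type*} {X : SerreGraph V E} {Γ : SerreGraph V' E'} (hX : X.IsTree)
  {ℓ : E → ℝ} (h0 : ∀ e, 0 ≤ ℓ e) (hbar : ∀ e, ℓ (X.bar e) = ℓ e)
  {F : Type*} [Group F] [MulAction F V] [MulAction F E] [Acts F X]
  {h : ℝ} {μ : X.Point → FiniteMeasure X.Boundary} (hμ : X.IsConformalDensity F ℓ h μ)

include hμ in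
theorem IsConformalDensity.absolutelyContinuous (x y : X.Point) :
    (μ x : Measure X.Boundary) ≪ (μ y : Measure X.Boundary) := by
  rw [hμ.density x y]
  exact withDensity_absolutelyContinuous _ _

/-- The measure class of a conformal density on the boundary of a tree is not concentrated at a
single end: such an end would be fixed by the group, which is not abelian. -/
theorem IsConformalDensity.offDiag_ne_zero [Countable E] {j : Covering X Γ} {x₀ : V}
    {α : F ≃* Γ.FundamentalGroup (j.onV x₀)} (hμ : X.IsConformalDensity F ℓ h μ)
    (hX : X.IsTree) (hact : ActsThrough F j x₀ α) {g g' : F} (hgg' : g * g' ≠ g' * g)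
    {z : X.Point} (hz : μ z ≠ 0) : X.offDiag (μ z) ≠ 0 := by
  intro h₀
  have h₁ : ((μ z : Measure X.Boundary).prod (μ z : Measure X.Boundary))
      {q : X.Boundary × X.Boundary | q.1 ≠ q.2} = 0 := by
    have := hX.offDiag_apply (μ z) Set.univ
    rw [h₀, Set.image_univ, Subtype.range_coe_subtype] at this
    exact this.symm
  have hz' : (μ z : Measure X.Boundary) ≠ 0 := fun h' => hz (Subtype.ext h')
  have : (ae (μ z : Measure X.Boundary)).NeBot := ae_neBot.2 hz'
  obtain ⟨ξ, hξ⟩ := ((Measure.measure_prod_null hX.measurableSet_offDiag).1 h₁).exists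
  have huniq {ξ' : X.Boundary} (hξ' : (μ z : Measure X.Boundary) {ζ | ξ' ≠ ζ} = 0) : ξ' = ξ := by
    by_contra hne
    refine hz' (Measure.measure_univ_eq_zero.1 (measure_mono_null (fun ζ _ => ?_)
      (measure_union_null (show (μ z : Measure X.Boundary) {ζ | ξ ≠ ζ} = 0 from hξ) hξ')))
    by_cases hζ : ξ = ζ
    · exact Or.inr fun h' => hne (h'.trans hζ.symm)
    · exact Or.inl hζ
  have hfix (g : F) : g • ξ = ξ := by
    have h₂ : (μ (g⁻¹ • z) : Measure X.Boundary) {ζ | ξ ≠ ζ} = 0 :=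
      hμ.absolutelyContinuous _ z hξ
    rw [hμ.equivariant] at h₂
    refine huniq (measure_mono_null (fun ζ hζ => ?_) (le_zero_iff.1
      ((Measure.le_map_apply (measurable_smul_boundary g⁻¹).aemeasurable _).trans_eq h₂)))
    show ξ ≠ g⁻¹ • ζ
    rintro rfl
    exact hζ (smul_inv_smul g ζ)
  exact hgg' (hact.commute_of_smul_end hX (hfix g) (hfix g'))

section

include hX h0 hbar hμ

/-- The measure `exp (2 h d(z, [ξ, ζ])) dμ_z(ξ) dμ_z(ζ)` does not depend on `z`: the changes of the
two factors cancel. -/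
theorem psMeasure_eq [Countable E] (z y : X.Point) :
    X.psMeasure ℓ h μ z = X.psMeasure ℓ h μ y := by
  have hm (z : X.Point) : Measurable fun q => ENNReal.ofReal (Real.exp (2 * h * X.distLine ℓ z q)) :=
    (Real.measurable_exp.comp ((measurable_distLine hX h0 hbar z).const_mul _)).ennreal_ofReal
  have hφ : Measurable fun ξ => ENNReal.ofReal (Real.exp (-h * X.busemann ℓ ξ z y)) :=
    (Real.measurable_exp.comp ((measurable_busemann hX h0 hbar z y).const_mul _)).ennreal_ofReal
  rw [psMeasure, hX.offDiag_withDensity hφ (hμ.density z y), ← withDensity_mul _ _ (hm z),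
    psMeasure]
  · congr 1
    ext q
    rw [Pi.mul_apply, ← ENNReal.ofReal_mul (Real.exp_pos _).le,
      ← ENNReal.ofReal_mul (by positivity), ← Real.exp_add, ← Real.exp_add]
    congr 2
    linear_combination h * two_mul_distLine_eq_add hX h0 hbar z y q
  · exact (hφ.comp (measurable_fst.comp measurable_subtype_coe)).mul
      (hφ.comp (measurable_snd.comp measurable_subtype_coe))

theorem psMeasure_cyl₂ [Countable E] (z : X.Point) {γ : List E} (hne : γ ≠ [])
    (hγ : X.IsReduced γ) :
    X.psMeasure ℓ h μ z (X.cyl₂ γ) =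
      (μ (X.vertex (X.o (γ.head hne))) : Measure X.Boundary) (X.cyl [X.bar (γ.head hne)]) *
      (μ (X.vertex (X.o (γ.head hne))) : Measure X.Boundary) (X.cyl [γ.getLast hne]) := by
  -- The origin of the path lies on all lines through it, so the density is `1` for this base point.
  rw [psMeasure_eq hX h0 hbar hμ z (X.vertex (X.o (γ.head hne))), psMeasure,
    withDensity_apply _ (measurableSet_cyl₂ hne hγ),
    setLIntegral_congr_fun (g := fun _ => 1) (measurableSet_cyl₂ hne hγ) fun q hq => by
      simp only [distLine_eq_zero hX h0 hbar (vertex_mem_line hne hq)]; simp,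
    setLIntegral_one, hX.offDiag_apply, hX.image_cyl₂ hne hγ, Measure.prod_prod]

end

theorem measure_cyl_of_busemann_eq (hμ : X.IsConformalDensity F ℓ h μ) {y : X.Point} {f : E} {C : ℝ}
    (hC : ∀ ξ ∈ X.cyl [f], X.busemann ℓ ξ y (X.vertex (X.o f)) = C) :
    (μ y : Measure X.Boundary) (X.cyl [f]) =
      ENNReal.ofReal (Real.exp (-h * C)) * X.weight μ f := by
  rw [hμ.density y (X.vertex (X.o f)), withDensity_apply _ (measurableSet_cyl _),
    setLIntegral_congr_fun (g := fun _ => ENNReal.ofReal (Real.exp (-h * C)))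
      (measurableSet_cyl _) fun ξ hξ => by simp only [hC ξ hξ],
    setLIntegral_const, weight]

theorem weight_smul (hμ : X.IsConformalDensity F ℓ h μ) (g : F) (f : E) :
    X.weight μ (g • f) = X.weight μ f := by
  rw [weight, Acts.smul_o, ← smul_vertex, hμ.equivariant,
    Measure.map_apply (measurable_smul_boundary g) (measurableSet_cyl _), weight]
  congr 1
  ext ξ
  simp only [Set.mem_preimage, mem_cyl_singleton]
  constructor
  · rintro ⟨r, hr, h⟩
    refine ⟨r.translate g⁻¹, ?_, ?_⟩
    · rw [← inv_smul_smul g ξ, ← hr]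
      rfl
    · rw [← inv_smul_smul g f, ← h]
      rfl
  · rintro ⟨r, rfl, rfl⟩
    exact ⟨r.translate g, rfl, rfl⟩

theorem mem_b [Fintype E'] {e f : E'} : f ∈ Γ.b e ↔ Γ.t e = Γ.o f ∧ f ≠ Γ.bar e := by
  simp [b]

/-- The ends in front of an edge are divided according to the edge that follows. -/
theorem measure_cyl_eq_sum [Fintype E'] {j : Covering X Γ} {x₀ : V}
    {α : F ≃* Γ.FundamentalGroup (j.onV x₀)} (hact : ActsThrough F j x₀ α) (hX : X.IsTree)
    (hμ : X.IsConformalDensity F ℓ h μ) {lift : E' → E}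
    (hlift : ∀ e, j.onE (lift e) = e) (a : E) {y : X.Point} {C : ℝ}
    (hC : ∀ f, X.t a = X.o f → f ≠ X.bar a →
      ∀ ξ ∈ X.cyl [f], X.busemann ℓ ξ y (X.vertex (X.o f)) = C) :
    (μ y : Measure X.Boundary) (X.cyl [a]) =
      ENNReal.ofReal (Real.exp (-h * C)) * ∑ e ∈ Γ.b (j.onE a), X.weight μ (lift e) := by
  have : Countable E := j.countable hX
  have : Nonempty E := ⟨a⟩
  have hex (e : E') (he : e ∈ Γ.b (j.onE a)) : ∃ f, X.o f = X.t a ∧ j.onE f = e :=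
    (j.lift (X.t a) e (by rw [j.onV_t]; exact (mem_b.1 he).1.symm)).exists
  choose! f hfo hfe using hex
  have hfa (e : E') (he : e ∈ Γ.b (j.onE a)) : f e ≠ X.bar a := by
    intro h'
    apply (mem_b.1 he).2
    rw [← j.onE_bar, ← h', hfe e he]
  have hcyl : X.cyl [a] = ⋃ e ∈ Γ.b (j.onE a), X.cyl [f e] := by
    ext ξ
    rw [Set.mem_iUnion₂]
    constructor
    · intro hξ
      obtain ⟨r, rfl, rfl⟩ := mem_cyl_singleton.1 hξ
      obtain ⟨hr, hr'⟩ := r.2 0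
      have he : j.onE (r.1 1) ∈ Γ.b (j.onE (r.1 0)) := by
        refine mem_b.2 ⟨by rw [← j.onV_t, j.onE_o, hr], fun h' => hr' ?_⟩
        exact j.onE_inj hr.symm (by rw [h', j.onE_bar])
      refine ⟨_, he, ?_⟩
      rw [j.onE_inj (e := f _) ((hfo _ he).trans hr) (hfe _ he)]
      exact r.toEnd_mem_cyl 1
    · rintro ⟨e, he, hξ⟩
      obtain ⟨r, rfl, hr⟩ := mem_cyl_singleton.1 hξ
      have hcons : X.t a = X.o (r.1 0) ∧ r.1 0 ≠ X.bar a := by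
        rw [hr]
        exact ⟨(hfo e he).symm, hfa e he⟩
      exact mem_cyl_singleton.2 ⟨Ray.cons a r hcons, Ray.toEnd_cons _, rfl⟩
  rw [hcyl, measure_biUnion_finset ?_ fun e _ => measurableSet_cyl _, Finset.mul_sum]
  · refine Finset.sum_congr rfl fun e he => ?_
    obtain ⟨g, hg⟩ := hact.exists_smul_eq hX ((hlift e).trans (hfe e he).symm)
    rw [measure_cyl_of_busemann_eq hμ (hC (f e) (hfo e he).symm (hfa e he)), ← hg,
      weight_smul hμ]
  · intro e he e' he' hne
    refine hX.disjoint_cyl ((hfo e he).trans (hfo e' he').symm) fun h' => hne ?_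
    rw [← hfe e he, h', hfe e' he']

theorem isPSCurrent_psMeasure [Finite E'] {j : Covering X Γ} {x₀ : V}
    {α : F ≃* Γ.FundamentalGroup (j.onV x₀)} (hact : ActsThrough F j x₀ α) (hX : X.IsTree)
    (h0 : ∀ e, 0 ≤ ℓ e) (hbar : ∀ e, ℓ (X.bar e) = ℓ e) (hℓ : ∀ (g : F) e, ℓ (g • e) = ℓ e)
    (hF : ∃ g g' : F, g * g' ≠ g' * g) (hμ : X.IsPattersonSullivan F ℓ μ) (z : X.Point) :
    X.IsPSCurrent F ℓ μ (X.psMeasure ℓ (X.criticalExponent F ℓ) μ z) := by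
  obtain ⟨hμ, x, hx⟩ := hμ
  have : Countable E := j.countable hX
  obtain ⟨g₁, g₂, hg⟩ := hF
  have hm (z : X.Point) : Measurable fun q =>
      ENNReal.ofReal (Real.exp (2 * X.criticalExponent F ℓ * X.distLine ℓ z q)) :=
    (Real.measurable_exp.comp ((measurable_distLine hX h0 hbar z).const_mul _)).ennreal_ofReal
  have hz : μ z ≠ 0 := fun h' => hx (Subtype.ext (Measure.absolutelyContinuous_zero_iff.1 (by
    have := hμ.absolutelyContinuous x z
    rwa [h'] at this)))
  have hac (z : X.Point) : X.offDiag (μ z) ≪ X.psMeasure ℓ (X.criticalExponent F ℓ) μ z :=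
    withDensity_absolutelyContinuous' (hm z).aemeasurable
      (ae_of_all _ fun q => by simp [Real.exp_pos])
  refine ⟨?_, ⟨fun q => ?_⟩, fun g => ?_, ?_, fun y => ⟨?_, ?_⟩, fun y => ?_⟩
  · intro h'
    have := hac z
    rw [h'] at this
    exact hμ.offDiag_ne_zero hX hact hg hz (Measure.absolutelyContinuous_zero_iff.1 this)
  · obtain ⟨e, he⟩ := hX.exists_mem_cyl₂ q
    have hr : X.IsReduced [e] := List.isChain_singleton e
    refine ⟨X.cyl₂ [e], (isOpen_cyl₂ (List.cons_ne_nil e []) hr).mem_nhds he, ?_⟩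
    rw [psMeasure_cyl₂ hX h0 hbar hμ z (List.cons_ne_nil e []) hr]
    exact ENNReal.mul_lt_top (measure_lt_top _ _) (measure_lt_top _ _)
  · rw [psMeasure, map_withDensity_of_comp _ (measurable_smul_boundary₂ g) (hm (g • z)) fun q => by
      rw [distLine_smul hℓ g z q], hX.offDiag_map_smul g (hμ.equivariant g z)]
    exact psMeasure_eq hX h0 hbar hμ (g • z) z
  · rw [psMeasure, map_withDensity_of_comp _ measurable_flip (hm z) fun q => by
      rw [distLine_flip], hX.offDiag_map_flip]
  · rw [psMeasure_eq hX h0 hbar hμ z y]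
    exact withDensity_absolutelyContinuous _ _
  · rw [psMeasure_eq hX h0 hbar hμ z y]
    exact hac y
  · refine ⟨1, X.distLine ℓ y, one_ne_zero, ENNReal.one_ne_top, measurable_distLine hX h0 hbar y,
      distLine_nonneg hX h0 hbar y, distLine_flip ℓ y,
      fun x => ⟨X.dist ℓ y x, abs_distLine_sub_le hX h0 hbar y x⟩, ?_⟩
    rw [one_smul]
    exact psMeasure_eq hX h0 hbar hμ z y

end Current

end SerreGraph

/-- Let `F` be a free group of rank `k ≥ 2`, `Γ` a finite connected graph without degree-one
vertices with a non-singular semi-metric structure `L`, `α : F ≃* π₁(Γ, p)` a simplicial chart,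
`j : X → Γ` the universal cover with the lifted lengths and the action of `F` through `α`. For any
Patterson–Sullivan measures `μ` on `∂X` and any point `z` of `X`, the measure
`exp (2 h d(z, [ξ, ζ])) dμ_z(ξ) dμ_z(ζ)` is a Patterson–Sullivan current, and its values on
cylinders are explicit. Here `lift e` is an arbitrary lift to `X` of each edge `e` of `Γ`. -/
theorem proposition5p3 {F : Type*} [Group F] (k : ℕ) (hk : 2 ≤ k)
    (hF : Nonempty (F ≃* FreeGroup (Fin k)))
    {VΓ EΓ VX EX : Type*} [Finite VΓ] [Fintype EΓ]
    (Γ : SerreGraph VΓ EΓ) (hΓ : Γ.IsConnected) (hdeg : ∀ v, ¬ ∃! e, Γ.o e = v)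
    (L : Γ.SemiMetric) (hL : L.Nonsingular)
    (X : SerreGraph VX EX) (hX : X.IsTree) (j : SerreGraph.Covering X Γ) (x₀ : VX)
    (α : F ≃* Γ.FundamentalGroup (j.onV x₀))
    [MulAction F VX] [MulAction F EX] [SerreGraph.Acts F X]
    (hact : SerreGraph.ActsThrough F j x₀ α)
    (ℓ : EX → ℝ) (hℓ : ∀ f, ℓ f = L.len (j.onE f))
    (h : ℝ) (hh : h = X.criticalExponent F ℓ)
    (μ : X.Point → FiniteMeasure X.Boundary) (hμ : X.IsPattersonSullivan F ℓ μ)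
    (z : X.Point) :
    X.IsPSCurrent F ℓ μ (X.psMeasure ℓ h μ z) ∧
    ∀ (lift : EΓ → EX), (∀ e, j.onE (lift e) = e) →
      ∀ (γ : List EX) (hne : γ ≠ []), X.IsReduced γ →
        X.psMeasure ℓ h μ z (X.cyl₂ γ) =
          ENNReal.ofReal (Real.exp (-h * (γ.map ℓ).sum)) *
            (∑ e ∈ Γ.b (Γ.bar (j.onE (γ.head hne))), X.weight μ (lift e)) *
            (∑ e ∈ Γ.b (j.onE (γ.getLast hne)), X.weight μ (lift e)) := by
  have h0 : ∀ f, 0 ≤ ℓ f := fun f => by rw [hℓ]; exact L.len_nonneg _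
  have hbar : ∀ f, ℓ (X.bar f) = ℓ f := fun f => by rw [hℓ, hℓ, j.onE_bar, L.len_bar]
  have hinv : ∀ (g : F) f, ℓ (g • f) = ℓ f := fun g f => by rw [hℓ, hℓ, hact.onE_smul]
  have : Countable EX := j.countable hX
  subst hh
  refine ⟨SerreGraph.isPSCurrent_psMeasure hact hX h0 hbar hinv
    (SerreGraph.exists_not_commute hk hF) hμ z, ?_⟩
  intro lift hlift γ hne hγ
  rw [SerreGraph.psMeasure_cyl₂ hX h0 hbar hμ.1 z hne hγ,
    SerreGraph.measure_cyl_eq_sum hact hX hμ.1 hlift (X.bar (γ.head hne)) (C := 0) ?_,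
    SerreGraph.measure_cyl_eq_sum hact hX hμ.1 hlift (γ.getLast hne) (C := (γ.map ℓ).sum) ?_,
    j.onE_bar]
  · simp only [mul_zero, Real.exp_zero, ENNReal.ofReal_one, one_mul]
    ring
  · intro f hf hf' ξ hξ
    refine SerreGraph.busemann_of_isReduced hX h0 hbar hne ?_ hξ
    refine List.IsChain.append hγ (List.isChain_singleton f) fun x hx y hy => ?_
    rw [List.getLast?_eq_some_getLast hne, Option.mem_some_iff] at hx
    rw [List.head?_cons, Option.mem_some_iff] at hy
    subst hx hy
    exact ⟨hf, hf'⟩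
  · intro f hf _ ξ _
    rw [← hf, SerreGraph.t_bar, SerreGraph.busemann_self hX h0 hbar]
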